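/- Let $a,b,A\in\mathbb C$, $\lambda>0$, $\mu<1$, and $\zeta\in\mathbb C$ with $|\zeta|=1$, $\zeta\ne1$. Let $\theta\in(0,\pi)$ be small enough that the sectors $|\arg z|\le\theta$ and $|\arg(z/\zeta)|\le\theta$ (without the origin) are disjoint and that $\lambda\theta<2\pi$, so that each of these sectors contains only one direction of maximal growth. Powers and arguments are principal. Let $f$ be an entire function such that, as $|z|\to\infty$, $$ f(z)=\begin{cases} z^a\exp(z^\lambda)\,[1+o(1)] & \text{for } |\arg z|\le\theta,\\ A(z/\zeta)^b\exp\bigl((z/\zeta)^\lambda\bigr)\,[1+o(1)] & \text{for } |\arg(z/\zeta)|\le\theta,\\ O\bigl(\exp(\mu|z|^\lambda)\bigr) & \text{otherwise,}\end{cases} $$ each estimate being uniform in its sector. Put $p_n(z)=\sum_{k=0}^n \frac{f^{(k)}(0)}{k!}z^k$, $r_n=(n/\lambda)^{1/\lambda}$ and $\alpha=\min\{\operatorname{Re}a,\operatorname{Re}b\}$, and let $S$ be the curve $$\bigl|z^\lambda\exp(1-z^\lambda)\bigr|=1,\qquad |z|\le1 .$$ Let $z_0\ne0$ with $|\arg z_0|<\theta$.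 1. If, for all large $n$, $z(n)$ is a zero of $p_{n-1}(r_nz)$, and $z(n)\to z_0$ as $n\to\infty$, then $z_0\in S$. 2. Suppose that $\operatorname{Re}a\neq\operatorname{Re}b$, or that $\operatorname{Re}a=\operatorname{Re}b$ and $|\zeta-z_0|\ne|A(1-z_0)|$. Let $n$ run through any sequence of indices tending to infinity, let $z(n)$ be a zero of $p_{n-1}(r_nz)$ for these $n$, and let $z(n)\to z_0$. Then $z_0\in S$. If moreover $z_0\ne1$, then $$\bigl|z(n)^\lambda\exp(1-z(n)^\lambda)\bigr|=1+\Bigl(\alpha-\operatorname{Re}b+\frac\lambda2\Bigr)\frac{\log n}{n}+O\!\left(\frac1n\right),$$ and the zeros approach $S$ from the exterior, $|z(n)^\lambda\exp(1-z(n)^\lambda)|>1$ for all large $n$, if $\alpha-\operatorname{Re}b+\lambda/2>0$, and from the interior, $|z(n)^\lambda\exp(1-z(n)^\lambda)|<1$ for all large $n$, if $\alpha-\operatorname{Re}b+\lambda/2<0$. -/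

import Mathlib

open Filter Topology Asymptotics

noncomputable section

/-- The closed sector `|arg (z / ω)| ≤ θ` bisected by the ray through `ω`. -/
def closedSector (ω : ℂ) (θ : ℝ) : Set ℂ :=
  {z : ℂ | |Complex.arg (z / ω)| ≤ θ}

/-- The growth of `f` as `|z| → ∞`: it is `z ^ a * exp (z ^ lam) * (1 + o(1))` uniformly in the sector
about the positive real axis, `A * (z / ζ) ^ b * exp ((z / ζ) ^ lam) * (1 + o(1))` uniformly in the
sector about the ray through `ζ`, and `O(exp (μ * |z| ^ lam))` uniformly in the rest of the plane.
All powers are principal. -/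
structure HasTwoDirections (f : ℂ → ℂ) (a b A ζ : ℂ) (lam μ θ : ℝ) : Prop where
  first : f ~[Bornology.cobounded ℂ ⊓ 𝓟 (closedSector 1 θ)]
    fun z => z ^ a * Complex.exp (z ^ (lam : ℂ))
  second : f ~[Bornology.cobounded ℂ ⊓ 𝓟 (closedSector ζ θ)]
    fun z => A * (z / ζ) ^ b * Complex.exp ((z / ζ) ^ (lam : ℂ))
  other : f =O[Bornology.cobounded ℂ ⊓ 𝓟 (closedSector 1 θ ∪ closedSector ζ θ)ᶜ]
    fun z => Real.exp (μ * ‖z‖ ^ lam)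

/-- The Maclaurin polynomial `p_n` of `f`, of degree at most `n`. -/
def maclaurinSum (f : ℂ → ℂ) (n : ℕ) (z : ℂ) : ℂ :=
  ∑ k ∈ Finset.range (n + 1), iteratedDeriv k f 0 / (k.factorial : ℂ) * z ^ k

/-- The scaling radius `r_n = (n / lam) ^ (1 / lam)`. -/
def scaleRadius (lam : ℝ) (n : ℕ) : ℝ :=
  ((n : ℝ) / lam) ^ (1 / lam)

/-- The modulus `|z ^ lam * exp (1 - z ^ lam)|`. -/
def szegoModulus (lam : ℝ) (z : ℂ) : ℝ :=
  ‖z ^ (lam : ℂ) * Complex.exp (1 - z ^ (lam : ℂ))‖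

/-- The limit curve. -/
def limitCurve (lam : ℝ) : Set ℂ :=
  {z : ℂ | szegoModulus lam z = 1 ∧ ‖z‖ ≤ 1}

/-- `n k → ∞`, and for large `k` the point `z k` is a zero of the scaled partial sum
`p_{n-1} (r_n z)` with `n = n k`, and `z k → z₀`. With `n = id` the points `z n` are zeros for all
large `n`; with a general `n` they are zeros along a subsequence. -/
def ZerosTendTo (f : ℂ → ℂ) (lam : ℝ) (n : ℕ → ℕ) (z : ℕ → ℂ) (z₀ : ℂ) : Prop :=
  Tendsto n atTop atTop ∧
  (∀ᶠ k in atTop, maclaurinSum f (n k - 1) ((scaleRadius lam (n k) : ℂ) * z k) = 0) ∧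
  Tendsto z atTop (𝓝 z₀)

end

/-! By Cauchy's formula, the difference between `f` (inside the contour) or `0` (outside) and the
partial sum `p_{n-1}` is a contour integral (`integral_circleKernel`). On a circle of radius about
`r_n` its integrand has two saddle points, on the rays through `1` and `ζ`, and is exponentially
smaller elsewhere. Laplace's method (`tendsto_integral_circleKernel`,
`HasTwoDirections.scaledRemainder_asymptotics`) evaluates the normalized integral as `r_n ^ a * u +
r_n ^ b * ζ ^ (-n) * v + e`, where `u` and `v` have nonzero limits when `z₀` is neither `1` nor `ζ`,
and `e` is smaller than every power of `r_n`. Unless the two terms cancel, its size is `r_n ^ max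
(Re a) (Re b)`.

At a zero of `p_{n-1}(r_n z)` the same integral is known exactly: it is `0` outside the contour, and
inside it comes from `f(r_n z)` alone, with size `√n * r_n ^ (Re a) * M ^ (-n/λ)` up to bounded
factors, where `M` is the modulus defining the curve
(`HasTwoDirections.norm_scaledRemainder_at_zeros`). Since the saddle points give a size that is only
a power of `n`, `M` can tend neither to a limit above `1` nor, inside the disc, to one below `1`;
limits outside the disc would make the integral vanish. Taking logarithms of the two sizes gives `n
log M = (Re a - max + λ/2) log n + O(1)`, and `Re a - max = min - Re b`.

Cancellation between the two terms is excluded either by different real parts or by `|U| ≠ |V|` for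
the limits `U`, `V` of `u`, `v`. Along all indices no such condition is needed: the relative phase
turns by about `ζ⁻¹ ≠ 1` at each step, so the terms cannot cancel for all large `n`
(`exists_frequently_rpow_max_le_norm`), and a lower bound at infinitely many indices already locates
the limit. -/

/-! ### Cauchy's formula for the remainder of the Maclaurin series. -/

/-- The integrand of the remainder integral over the circle of radius `r * exp h`,
in the angular variable. -/
noncomputable def circleKernel (f : ℂ → ℂ) (n : ℕ) (r h : ℝ) (w : ℂ) (φ : ℝ) : ℂ :=
  f (r * Complex.exp (h + φ * Complex.I)) * Complex.exp (-(n * (h + φ * Complex.I))) *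
    (Complex.exp (h + φ * Complex.I) / (Complex.exp (h + φ * Complex.I) - w))

theorem norm_exp_add_mul_I (h φ : ℝ) : ‖Complex.exp (h + φ * Complex.I)‖ = Real.exp h := by
  rw [Complex.norm_exp]; simp

/-- The geometric sum splits `(z/s)^n / (s - z)` into `1/(s - z)` minus `∑ z^k / s^(k+1)` over `k <
n`. The first piece gives `f z` or `0` according to the side of the circle on which `z` lies; the
others give the Taylor coefficients. -/
theorem circleIntegral_cauchy_remainder {f : ℂ → ℂ} (hf : Differentiable ℂ f) (n : ℕ) {R : ℝ}
    (hR : 0 < R) {z : ℂ} (hz : ‖z‖ ≠ R) :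
    (∮ s in C(0, R), f s * ((z / s) ^ n / (s - z))) =
      2 * Real.pi * Complex.I * ((if ‖z‖ < R then f z else 0) -
        ∑ k ∈ Finset.range n, iteratedDeriv k f 0 / (k.factorial : ℂ) * z ^ k) := by
  have hs0 : ∀ s ∈ Metric.sphere (0 : ℂ) R, s ≠ 0 := by
    rintro s hs rfl
    simp at hs
    exact hR.ne hs
  have hsz : ∀ s ∈ Metric.sphere (0 : ℂ) R, s - z ≠ 0 := by
    intro s hs h
    rw [sub_eq_zero] at h
    subst h
    simp at hs
    exact hz hs
  have h1 : (∮ s in C(0, R), (s - z)⁻¹ * f s) =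
      2 * Real.pi * Complex.I * (if ‖z‖ < R then f z else 0) := by
    split_ifs with h
    · simpa using (hf.diffContOnCl (s := Metric.ball 0 R)).circleIntegral_sub_inv_smul
        (w := z) (by simpa using h)
    · rw [mul_zero]
      have hlt : R < ‖z‖ := lt_of_le_of_ne (not_lt.mp h) (Ne.symm hz)
      have hne : ∀ s ∈ Metric.closedBall (0 : ℂ) R, s - z ≠ 0 := by
        intro s hs h
        rw [sub_eq_zero] at h
        subst h
        simp at hs
        linarith
      have hd : ∀ s ∈ Metric.closedBall (0 : ℂ) R,
          DifferentiableAt ℂ (fun s => (s - z)⁻¹ * f s) s := by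
        intro s hs
        exact ((differentiableAt_id.sub_const z).inv (hne s hs)).mul (hf s)
      exact Complex.circleIntegral_eq_zero_of_differentiable_on_off_countable hR.le
        Set.countable_empty (fun s hs => (hd s hs).continuousAt.continuousWithinAt)
        (fun s hs => hd s (Metric.ball_subset_closedBall hs.1))
  have h2 : ∀ k : ℕ, (∮ s in C(0, R), z ^ k * (1 / (s - 0) ^ (k + 1) * f s)) =
      2 * Real.pi * Complex.I * (iteratedDeriv k f 0 / (k.factorial : ℂ) * z ^ k) := by
    intro k
    have := hf.differentiableOn.circleIntegral_one_div_sub_center_pow_smul (c := 0) hR k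
    simp only [smul_eq_mul] at this
    rw [circleIntegral.integral_const_mul, this]
    ring
  have hint : ∀ k : ℕ, CircleIntegrable (fun s => z ^ k * (1 / (s - 0) ^ (k + 1) * f s)) 0 R := by
    intro k
    refine ContinuousOn.circleIntegrable hR.le ?_
    refine continuousOn_const.mul (ContinuousOn.mul ?_ hf.continuous.continuousOn)
    exact continuousOn_const.div (by fun_prop) (fun s hs => by
      simpa using hs0 s hs)
  have hint0 : CircleIntegrable (fun s => (s - z)⁻¹ * f s) 0 R := by
    refine ContinuousOn.circleIntegrable hR.le ?_
    exact (ContinuousOn.inv₀ (by fun_prop) hsz).mul hf.continuous.continuousOn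
  rw [mul_sub, ← h1, Finset.mul_sum, ← Finset.sum_congr rfl (fun k _ => h2 k),
    ← circleIntegral.integral_fun_sum (fun k _ => hint k), ← circleIntegral.integral_sub hint0]
  · refine circleIntegral.integral_congr hR.le ?_
    intro s hs
    have a0 := hs0 s hs
    have a1 := hsz s hs
    have key : ∑ k ∈ Finset.range n, z ^ k / s ^ (k + 1) = (1 - (z / s) ^ n) / (s - z) := by
      induction n with
      | zero => simp
      | succ m ih =>
        rw [Finset.sum_range_succ, ih, div_pow, div_pow]
        field_simp
        ring
    have : ∑ k ∈ Finset.range n, z ^ k * (1 / (s - 0) ^ (k + 1) * f s) =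
        (∑ k ∈ Finset.range n, z ^ k / s ^ (k + 1)) * f s := by
      rw [Finset.sum_mul]
      refine Finset.sum_congr rfl fun k _ => ?_
      rw [sub_zero]
      ring
    simp only [this, key]
    field_simp
    ring
  · exact CircleIntegrable.fun_sum _ fun k _ => hint k

theorem integral_circleKernel {f : ℂ → ℂ} (hf : Differentiable ℂ f) (n : ℕ) {r : ℝ}
    (hr : 0 < r) (h : ℝ) {z : ℂ} (hz : ‖z‖ ≠ Real.exp h) :
    z ^ n * ∫ φ in (0 : ℝ)..(2 * Real.pi), circleKernel f n r h z φ =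
      2 * Real.pi * ((if ‖z‖ < Real.exp h then f (r * z) else 0) -
        ∑ k ∈ Finset.range n, iteratedDeriv k f 0 / (k.factorial : ℂ) * (r * z) ^ k) := by
  have hrC : (r : ℂ) ≠ 0 := by exact_mod_cast hr.ne'
  have hn : ‖(r : ℂ) * z‖ = r * ‖z‖ := by
    rw [norm_mul, Complex.norm_real, Real.norm_of_nonneg hr.le]
  have key := circleIntegral_cauchy_remainder hf n (R := r * Real.exp h) (by positivity)
    (z := r * z) (by rw [hn]; exact fun e => hz (mul_left_cancel₀ hr.ne' e))
  rw [hn] at key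
  simp only [mul_lt_mul_iff_right₀ hr] at key
  have hI := Complex.I_ne_zero
  have e : (∮ s in C(0, r * Real.exp h), f s * ((r * z / s) ^ n / (s - r * z))) =
      Complex.I * (z ^ n * ∫ φ in (0 : ℝ)..(2 * Real.pi), circleKernel f n r h z φ) := by
    rw [circleIntegral, ← intervalIntegral.integral_const_mul,
      ← intervalIntegral.integral_const_mul]
    refine intervalIntegral.integral_congr fun φ _ => ?_
    have hw : circleMap 0 (r * Real.exp h) φ = r * Complex.exp (h + φ * Complex.I) := by
      rw [circleMap, Complex.exp_add]
      push_cast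
      ring
    have hE := Complex.exp_ne_zero (h + φ * Complex.I)
    have hd : Complex.exp (h + φ * Complex.I) - z ≠ 0 := by
      rw [sub_ne_zero]
      intro e
      apply hz
      rw [← e, norm_exp_add_mul_I]
    simp only [deriv_circleMap, hw, circleKernel, smul_eq_mul]
    have : (r * z / (r * Complex.exp (h + φ * Complex.I))) ^ n =
        z ^ n * Complex.exp (-(n * (h + φ * Complex.I))) := by
      rw [mul_div_mul_left _ _ hrC, div_pow, Complex.exp_neg, Complex.exp_nat_mul]
      rfl
    rw [this, ← mul_sub]
    field_simp
  rw [e] at key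
  apply mul_left_cancel₀ hI
  rw [key]
  ring

/-! ### The scaling radius and the normalized kernel. -/

theorem scaleRadius_pos {lam : ℝ} (hlam : 0 < lam) {n : ℕ} (hn : 0 < n) :
    0 < scaleRadius lam n := by
  have : (0 : ℝ) < n := by exact_mod_cast hn
  unfold scaleRadius
  positivity

theorem scaleRadius_rpow {lam : ℝ} (hlam : 0 < lam) (n : ℕ) :
    scaleRadius lam n ^ lam = n / lam := by
  unfold scaleRadius
  rw [← Real.rpow_mul (by positivity), one_div_mul_cancel hlam.ne', Real.rpow_one]

theorem tendsto_scaleRadius {lam : ℝ} (hlam : 0 < lam) :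
    Tendsto (scaleRadius lam) atTop atTop := by
  unfold scaleRadius
  exact (tendsto_rpow_atTop (by positivity)).comp
    (tendsto_natCast_atTop_atTop.atTop_div_const hlam)

theorem ofReal_mul_exp_cpow {r : ℝ} (hr : 0 < r) {w : ℂ} (h1 : -Real.pi < w.im)
    (h2 : w.im ≤ Real.pi) (a : ℂ) :
    ((r : ℂ) * Complex.exp w) ^ a = (r : ℂ) ^ a * Complex.exp (a * w) := by
  have hrC : (r : ℂ) ≠ 0 := by exact_mod_cast hr.ne'
  rw [Complex.cpow_def_of_ne_zero (mul_ne_zero hrC (Complex.exp_ne_zero w)),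
    Complex.log_ofReal_mul hr (Complex.exp_ne_zero w), Complex.log_exp h1 h2,
    Complex.cpow_def_of_ne_zero hrC, Complex.ofReal_log hr.le, add_mul, Complex.exp_add,
    mul_comm w a]

theorem scaleRadius_mul_exp_cpow {lam : ℝ} (hlam : 0 < lam) {n : ℕ} (hn : 0 < n) {w : ℂ}
    (h1 : -Real.pi < w.im) (h2 : w.im ≤ Real.pi) :
    ((scaleRadius lam n : ℂ) * Complex.exp w) ^ (lam : ℂ) =
      (n / lam : ℝ) * Complex.exp (lam * w) := by
  rw [ofReal_mul_exp_cpow (scaleRadius_pos hlam hn) h1 h2,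
    ← Complex.ofReal_cpow (scaleRadius_pos hlam hn).le, scaleRadius_rpow hlam]

/-- The kernel, normalized, in terms of the ratio of `g` to its asymptotic model. -/
theorem circleKernel_normalized {lam : ℝ} (hlam : 0 < lam) {n : ℕ} (hn : 0 < n) (g : ℂ → ℂ)
    (a w : ℂ) (h φ : ℝ) (h1 : -Real.pi < φ) (h2 : φ ≤ Real.pi) :
    circleKernel g n (scaleRadius lam n) h w φ *
        (Complex.exp (-(n / lam : ℝ)) * (scaleRadius lam n : ℂ) ^ (-a)) =
      (fun z => g z / (z ^ a * Complex.exp (z ^ (lam : ℂ))))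
          (scaleRadius lam n * Complex.exp (h + φ * Complex.I)) *
        Complex.exp (a * (h + φ * Complex.I)) *
        Complex.exp (n * (Complex.exp (lam * (h + φ * Complex.I)) / lam -
          (h + φ * Complex.I) - 1 / lam)) *
        (Complex.exp (h + φ * Complex.I) / (Complex.exp (h + φ * Complex.I) - w)) := by
  have hr := scaleRadius_pos hlam hn
  have hrC : (scaleRadius lam n : ℂ) ≠ 0 := by exact_mod_cast hr.ne'
  set W : ℂ := h + φ * Complex.I with hW
  have hWim : W.im = φ := by simp [hW]
  have e1 := ofReal_mul_exp_cpow hr (w := W) (by rwa [hWim]) (by rwa [hWim]) a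
  have e2 := scaleRadius_mul_exp_cpow hlam hn (w := W) (by rwa [hWim]) (by rwa [hWim])
  have hra : (scaleRadius lam n : ℂ) ^ a ≠ 0 := by simp [Complex.cpow_eq_zero_iff, hrC]
  have hl : (lam : ℂ) ≠ 0 := by exact_mod_cast hlam.ne'
  simp only [circleKernel, ← hW, e1, e2]
  -- The radius is chosen so that `r_n ^ λ = n / λ`: the exponent becomes `n` times a fixed phase of
  -- `W`, which vanishes to second order at `W = 0`.
  have e3 : Complex.exp (n * (Complex.exp (lam * W) / lam - W - 1 / lam)) =
      Complex.exp ((n / lam : ℝ) * Complex.exp (lam * W)) * Complex.exp (-(n * W)) *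
        Complex.exp (-(n / lam : ℝ)) := by
    rw [← Complex.exp_add, ← Complex.exp_add]
    congr 1
    push_cast
    field_simp
    ring
  rw [e3, Complex.cpow_neg]
  have := Complex.exp_ne_zero (a * W)
  have := Complex.exp_ne_zero ((n / lam : ℝ) * Complex.exp (lam * W))
  field_simp

theorem arg_ofReal_mul_exp {r : ℝ} (hr : 0 < r) (h : ℝ) {φ : ℝ} (h1 : -Real.pi < φ)
    (h2 : φ ≤ Real.pi) : Complex.arg (r * Complex.exp (h + φ * Complex.I)) = φ := by
  rw [Complex.arg_real_mul _ hr, ← Complex.log_im, Complex.log_exp (by simpa) (by simpa)]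
  simp

/-! ### Laplace's method at one saddle point. -/

theorem tendsto_height {x h : ℕ → ℝ} (hx : Tendsto x atTop atTop)
    (h0 : ∀ k, 0 ≤ h k) (h1 : ∀ k, h k * x k ≤ 1) : Tendsto h atTop (𝓝 0) := by
  refine tendsto_of_tendsto_of_tendsto_of_le_of_le' tendsto_const_nhds
    (tendsto_inv_atTop_zero.comp hx) (Eventually.of_forall h0) ?_
  filter_upwards [hx.eventually_gt_atTop 0] with k hk
  rw [Function.comp, ← one_div, le_div_iff₀ hk]
  exact h1 k

/-- The second-order behaviour of the phase at the saddle point. -/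
theorem tendsto_phase {lam : ℝ} (hlam : 0 < lam) {x h : ℕ → ℝ} (hx : Tendsto x atTop atTop)
    (h0 : ∀ k, 0 ≤ h k) (h1 : ∀ k, h k * x k ≤ 1) (u : ℝ) :
    Tendsto (fun k => (x k : ℂ) * (Complex.exp (lam * (h k + (u / √(x k) : ℝ) * Complex.I)) / lam -
      (h k + (u / √(x k) : ℝ) * Complex.I) - 1 / lam)) atTop (𝓝 (-(lam / 2 * u ^ 2 : ℝ))) := by
  have hh0 : Tendsto h atTop (𝓝 0) := tendsto_height hx h0 h1
  have hφ0 : Tendsto (fun k => u / √(x k)) atTop (𝓝 0) :=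
    (Real.tendsto_sqrt_atTop.comp hx).const_div_atTop u
  set W : ℕ → ℂ := fun k => (h k : ℂ) + (u / √(x k) : ℝ) * Complex.I with hWdef
  have hW : Tendsto W atTop (𝓝 0) := by
    have := ((Complex.continuous_ofReal.tendsto _).comp hh0).add
      (((Complex.continuous_ofReal.tendsto _).comp hφ0).mul_const Complex.I)
    simpa [hWdef] using this
  have hb : IsBoundedUnder (· ≤ ·) atTop (norm ∘ fun k => h k * x k) := by
    refine ⟨1, eventually_map.mpr ?_⟩
    filter_upwards [hx.eventually_gt_atTop 0] with k hk
    rw [Function.comp, Real.norm_of_nonneg (mul_nonneg (h0 k) hk.le)]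
    exact h1 k
  -- Because `h * x ≤ 1` and `h → 0`, the displacement of the contour contributes nothing in the
  -- limit; only `(i u)²` survives.
  have hsq : Tendsto (fun k => (x k : ℂ) * W k ^ 2) atTop (𝓝 (-(u ^ 2 : ℝ))) := by
    have a1 : Tendsto (fun k => (h k * x k) * h k) atTop (𝓝 0) := isBoundedUnder_le_mul_tendsto_zero hb hh0
    have a2 : Tendsto (fun k => (h k * x k) * (u / √(x k))) atTop (𝓝 0) :=
      isBoundedUnder_le_mul_tendsto_zero hb hφ0
    have := (((Complex.continuous_ofReal.tendsto _).comp a1).add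
      (((Complex.continuous_ofReal.tendsto _).comp a2).mul_const (2 * Complex.I))).sub_const
        ((u ^ 2 : ℝ) : ℂ)
    refine Tendsto.congr' ?_ (by simpa using this)
    filter_upwards [hx.eventually_gt_atTop 0] with k hk
    have e : (x k : ℂ) * (u / √(x k) : ℝ) ^ 2 = (u ^ 2 : ℝ) := by
      norm_cast
      rw [div_pow, Real.sq_sqrt hk.le]
      field_simp
    simp only [hWdef]
    push_cast at e ⊢
    linear_combination e - (x k : ℂ) * ((u : ℂ) / √(x k)) ^ 2 * Complex.I_sq
  -- The cubic Taylor remainder is negligible: it is of order `x * |W|³`, while `x * |W|²` stays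
  -- bounded.
  have herr : Tendsto (fun k => (x k : ℂ) * (Complex.exp (lam * W k) -
      ∑ m ∈ Finset.range 3, (lam * W k) ^ m / (m.factorial : ℂ))) atTop (𝓝 0) := by
    have hlw : Tendsto (fun k => lam * W k) atTop (𝓝 0) := by simpa using hW.const_mul (lam : ℂ)
    have hz : Tendsto (fun k => ‖(x k : ℂ) * W k ^ 2‖ * (lam ^ 2 * (‖lam * W k‖ *
        Real.exp ‖lam * W k‖))) atTop (𝓝 0) := by
      have := hsq.norm.mul ((hlw.norm.mul
        ((Real.continuous_exp.tendsto _).comp hlw.norm)).const_mul (lam ^ 2))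
      simpa using this
    refine squeeze_zero_norm (fun k => ?_) hz
    rw [norm_mul]
    refine (mul_le_mul_of_nonneg_left
      (Complex.norm_exp_sub_sum_le_norm_mul_exp (lam * W k) 3) (norm_nonneg _)).trans_eq ?_
    rw [norm_mul, norm_mul, norm_pow, Complex.norm_real lam, Real.norm_of_nonneg hlam.le]
    ring
  have hl : (lam : ℂ) ≠ 0 := by exact_mod_cast hlam.ne'
  have := (hsq.const_mul ((lam : ℂ) / 2)).add (herr.div_const (lam : ℂ))
  refine Tendsto.congr (fun k => ?_) (by convert this using 2; push_cast; ring)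
  rw [show (h k : ℂ) + (u / √(x k) : ℝ) * Complex.I = W k from rfl]
  simp only [Finset.sum_range_succ, Finset.sum_range_zero, Nat.factorial]
  push_cast
  field_simp
  ring

/-- The Gaussian majorant for dominated convergence. The term linear in `h` cancels, the quadratic
one costs at most `λ` because `h * x ≤ 1` and `h ≤ 1`, and `cos t ≤ 1 - 2t²/π²` on `|t| ≤ π`
supplies the decay in `φ`. -/
theorem phase_re_le {lam : ℝ} (hlam : 0 < lam) {x h φ : ℝ} (hx : 0 < x) (h0 : 0 ≤ h)
    (h1 : h * x ≤ 1) (h2 : h ≤ 1) (h3 : lam * h ≤ 1) (hφ : |lam * φ| ≤ Real.pi) :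
    ((x : ℂ) * (Complex.exp (lam * (h + φ * Complex.I)) / lam -
      (h + φ * Complex.I) - 1 / lam)).re ≤ lam - 2 * lam / Real.pi ^ 2 * (x * φ ^ 2) := by
  have e : (lam * (h + φ * Complex.I) : ℂ) = (lam * h : ℝ) + (lam * φ : ℝ) * Complex.I := by
    push_cast
    ring
  have e2 : ((x : ℂ) * (Complex.exp (lam * (h + φ * Complex.I)) / lam -
      (h + φ * Complex.I) - 1 / lam)).re =
      x * (Real.exp (lam * h) * Real.cos (lam * φ) / lam - h - 1 / lam) := by
    rw [Complex.re_ofReal_mul, e, Complex.sub_re, Complex.sub_re, Complex.div_ofReal_re,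
      Complex.exp_re, ← Complex.ofReal_one, ← Complex.ofReal_div]
    simp
  rw [e2]
  have hcos := Real.cos_le_one_sub_mul_cos_sq hφ
  have he1 : 1 ≤ Real.exp (lam * h) := Real.one_le_exp (by positivity)
  have he2 : Real.exp (lam * h) ≤ 1 + lam * h + (lam * h) ^ 2 := by
    have := Real.abs_exp_sub_one_sub_id_le (x := lam * h)
      (by rwa [abs_of_nonneg (by positivity)])
    linarith [(abs_le.mp this).2]
  set q := 2 / Real.pi ^ 2 * (lam * φ) ^ 2 with hq
  have hq0 : 0 ≤ q := by positivity
  have h4 : Real.exp (lam * h) * Real.cos (lam * φ) ≤ 1 + lam * h + (lam * h) ^ 2 - q := by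
    calc _ ≤ Real.exp (lam * h) * (1 - q) := by gcongr
      _ ≤ _ := by nlinarith
  have h5 : x * (Real.exp (lam * h) * Real.cos (lam * φ) / lam - h - 1 / lam) ≤
      x * ((1 + lam * h + (lam * h) ^ 2 - q) / lam - h - 1 / lam) := by gcongr
  refine h5.trans ?_
  have h6 : x * ((1 + lam * h + (lam * h) ^ 2 - q) / lam - h - 1 / lam) =
      lam * (h * x) * h - 2 * lam / Real.pi ^ 2 * (x * φ ^ 2) := by
    rw [hq]
    field_simp
    ring
  rw [h6]
  have h7 : (h * x) * h ≤ 1 := mul_le_one₀ h1 h0 h2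
  nlinarith

/-- Substituting `φ = u / √n` turns the integrand into one converging pointwise to a Gaussian times
`c / (1 - w₀)`. The hypothesis `hsep` keeps the Cauchy factor bounded uniformly on the arc, as
domination requires. -/
theorem tendsto_integral_circleKernel {lam : ℝ} (hlam : 0 < lam) {θ δ : ℝ} (hδ : 0 < δ)
    (hδθ : δ ≤ θ) (hδπ : δ < Real.pi) (hδl : lam * δ ≤ Real.pi) {g : ℂ → ℂ} (hg : Continuous g)
    {a c : ℂ} (hasymp : Tendsto (fun z => g z / (z ^ a * Complex.exp (z ^ (lam : ℂ))))
      (Bornology.cobounded ℂ ⊓ 𝓟 (closedSector 1 θ)) (𝓝 c))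
    {n : ℕ → ℕ} (hn : Tendsto n atTop atTop) {h : ℕ → ℝ} (h0 : ∀ k, 0 ≤ h k)
    (h1 : ∀ k, h k * n k ≤ 1) {w : ℕ → ℂ} {w₀ : ℂ} (hw : Tendsto w atTop (𝓝 w₀)) (hw₀ : w₀ ≠ 1)
    {m : ℝ} (hm : 0 < m)
    (hsep : ∀ᶠ k in atTop, ∀ φ : ℝ, |φ| ≤ δ → m ≤ ‖Complex.exp (h k + φ * Complex.I) - w k‖) :
    Tendsto (fun k => (√(n k) : ℂ) * (Complex.exp (-(n k / lam : ℝ)) *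
        (scaleRadius lam (n k) : ℂ) ^ (-a)) *
        ∫ φ in (-δ)..δ, circleKernel g (n k) (scaleRadius lam (n k)) (h k) (w k) φ)
      atTop (𝓝 (√(2 * Real.pi / lam) * (c / (1 - w₀)))) := by
  have hxn : Tendsto (fun k => (n k : ℝ)) atTop atTop := tendsto_natCast_atTop_atTop.comp hn
  have hh0 : Tendsto h atTop (𝓝 0) := tendsto_height hxn h0 h1
  have hsq : Tendsto (fun k => √(n k : ℝ)) atTop atTop :=
    Real.tendsto_sqrt_atTop.comp hxn
  set rel : ℂ → ℂ := fun z => g z / (z ^ a * Complex.exp (z ^ (lam : ℂ))) with hrel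
  set G : ℕ → ℝ → ℂ := fun k φ => circleKernel g (n k) (scaleRadius lam (n k)) (h k) (w k) φ *
    (Complex.exp (-(n k / lam : ℝ)) * (scaleRadius lam (n k) : ℂ) ^ (-a)) with hG
  -- the rescaled integrand
  set F : ℕ → ℝ → ℂ := fun k =>
    (Set.Ioc (-(δ * √(n k))) (δ * √(n k))).indicator fun u => G k (u / √(n k)) with hF
  have hint : ∀ᶠ k in atTop, (√(n k) : ℂ) * (Complex.exp (-(n k / lam : ℝ)) *
        (scaleRadius lam (n k) : ℂ) ^ (-a)) *
        (∫ φ in (-δ)..δ, circleKernel g (n k) (scaleRadius lam (n k)) (h k) (w k) φ) =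
      ∫ u, F k u := by
    filter_upwards [hsq.eventually_gt_atTop 0] with k hk
    have : (∫ u, F k u) = ∫ u in (-(δ * √(n k)))..(δ * √(n k)), G k (u / √(n k)) := by
      rw [hF, intervalIntegral.integral_of_le (by nlinarith),
        MeasureTheory.integral_indicator measurableSet_Ioc]
    rw [this, intervalIntegral.integral_comp_div _ hk.ne', ← neg_mul,
      mul_div_cancel_right₀ _ hk.ne', mul_div_cancel_right₀ _ hk.ne', hG]
    simp only
    rw [intervalIntegral.integral_mul_const, Complex.real_smul]
    ring
  refine Tendsto.congr' (EventuallyEq.symm hint) ?_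
  have hgauss : (∫ u : ℝ, (Complex.exp (-(lam / 2 * u ^ 2 : ℝ)) * (c / (1 - w₀)) : ℂ)) =
      √(2 * Real.pi / lam) * (c / (1 - w₀)) := by
    rw [MeasureTheory.integral_mul_const]
    congr 1
    have := integral_gaussian (lam / 2)
    rw [show Real.pi / (lam / 2) = 2 * Real.pi / lam by field_simp] at this
    rw [← this, ← integral_complex_ofReal]
    congr 1
    ext u
    push_cast
    ring_nf
  rw [← hgauss]
  -- bounds for the ratio
  obtain ⟨R, hR⟩ : ∃ R : ℝ, ∀ z : ℂ, R ≤ ‖z‖ → z ∈ closedSector 1 θ → ‖rel z‖ ≤ ‖c‖ + 1 := by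
    have h := hasymp.norm.eventually_le_const (lt_add_one ‖c‖)
    rw [eventually_inf_principal, ← comap_norm_atTop, eventually_comap] at h
    obtain ⟨R, hR⟩ := eventually_atTop.mp h
    exact ⟨R, fun z hz hs => hR _ hz z rfl hs⟩
  have hrad : Tendsto (fun k => scaleRadius lam (n k)) atTop atTop :=
    (tendsto_scaleRadius hlam).comp hn
  have hsector : ∀ (r h φ : ℝ), 0 < r → |φ| ≤ δ →
      (r : ℂ) * Complex.exp (h + φ * Complex.I) ∈ closedSector 1 θ := by
    intro r h φ hr hφ
    have hφ' := abs_le.mp hφ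
    change |Complex.arg _| ≤ θ
    rw [div_one, arg_ofReal_mul_exp hr h (by linarith) (by linarith)]
    exact hφ.trans hδθ
  have hnorm : ∀ (r h φ : ℝ), 0 < r → 0 ≤ h →
      r ≤ ‖(r : ℂ) * Complex.exp (h + φ * Complex.I)‖ := by
    intro r h φ hr hh
    rw [norm_mul, norm_exp_add_mul_I, Complex.norm_real, Real.norm_of_nonneg hr.le]
    exact le_mul_of_one_le_right hr.le (Real.one_le_exp hh)
  -- One factor for each of: the ratio of `g` to its model, `exp (a * W)`, the constant in
  -- `phase_re_le`, and the Cauchy factor.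
  set B : ℝ := (‖c‖ + 1) * Real.exp (‖a‖ * (1 + δ)) * Real.exp lam * (Real.exp 1 / m) with hB
  refine MeasureTheory.tendsto_integral_filter_of_dominated_convergence
    (fun u => B * Real.exp (-(2 * lam / Real.pi ^ 2) * u ^ 2)) ?_ ?_ ?_ ?_
  · refine Eventually.of_forall fun k => Measurable.aestronglyMeasurable ?_
    refine Measurable.indicator ?_ measurableSet_Ioc
    have := hg.measurable
    simp only [hG, circleKernel]
    fun_prop
  · filter_upwards [hsq.eventually_gt_atTop 0, hsep, hrad.eventually_ge_atTop R,
      hh0.eventually_le_const one_pos, (hh0.const_mul lam).eventually_le_const (by simp : lam * 0 < 1),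
      hn.eventually_gt_atTop 0] with k hk hsepk hRk hk1 hkl hnk
    refine Eventually.of_forall fun u => ?_
    by_cases hu : u ∈ Set.Ioc (-(δ * √(n k))) (δ * √(n k))
    · simp only [hF, Set.indicator_of_mem hu]
      set φ := u / √(n k) with hφ
      have hφδ : |φ| ≤ δ := by
        rw [hφ, abs_div, abs_of_pos hk, div_le_iff₀ hk]
        exact abs_le.mpr ⟨hu.1.le, hu.2⟩
      have hφ' := abs_le.mp hφδ
      have hnp : (0 : ℝ) < n k := by exact_mod_cast hnk
      have hφu : (n k : ℝ) * φ ^ 2 = u ^ 2 := by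
        rw [hφ, div_pow, Real.sq_sqrt hnp.le]
        field_simp
      rw [hG]
      simp only
      rw [circleKernel_normalized hlam hnk g a _ _ _ (by linarith) (by linarith)]
      rw [norm_mul, norm_mul, norm_mul, norm_div (Complex.exp _), norm_exp_add_mul_I]
      have b1 := hR _ (hRk.trans (hnorm _ (h k) φ (scaleRadius_pos hlam hnk) (h0 k)))
        (hsector _ (h k) φ (scaleRadius_pos hlam hnk) hφδ)
      have b2 : ‖Complex.exp (a * (h k + φ * Complex.I))‖ ≤ Real.exp (‖a‖ * (1 + δ)) := by
        refine (Complex.norm_exp_le_exp_norm _).trans (Real.exp_le_exp.mpr ?_)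
        rw [norm_mul]
        gcongr
        refine (norm_add_le _ _).trans ?_
        rw [norm_mul, Complex.norm_I, Complex.norm_real, Complex.norm_real, mul_one,
          Real.norm_of_nonneg (h0 k)]
        exact add_le_add hk1 hφδ
      have b3 : ‖Complex.exp (n k * (Complex.exp (lam * (h k + φ * Complex.I)) / lam -
          (h k + φ * Complex.I) - 1 / lam))‖ ≤
          Real.exp lam * Real.exp (-(2 * lam / Real.pi ^ 2) * u ^ 2) := by
        rw [Complex.norm_exp, ← Real.exp_add]
        refine Real.exp_le_exp.mpr ?_
        have := phase_re_le hlam (x := n k) (φ := φ) hnp (h0 k) (h1 k) hk1 hkl (by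
          rw [abs_mul, abs_of_pos hlam]
          exact (mul_le_mul_of_nonneg_left hφδ hlam.le).trans hδl)
        rw [hφu] at this
        push_cast at this
        linarith
      have b4 : Real.exp (h k) / ‖Complex.exp (h k + φ * Complex.I) - w k‖ ≤ Real.exp 1 / m := by
        have := hsepk φ hφδ
        gcongr
      rw [hB]
      calc _ ≤ (‖c‖ + 1) * Real.exp (‖a‖ * (1 + δ)) *
            (Real.exp lam * Real.exp (-(2 * lam / Real.pi ^ 2) * u ^ 2)) * (Real.exp 1 / m) := by
            gcongr
        _ = _ := by ring
    · simp only [hF, Set.indicator_of_notMem hu, norm_zero]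
      positivity
  · exact (integrable_exp_neg_mul_sq (by positivity)).const_mul _
  · refine Eventually.of_forall fun u => ?_
    have hφ0 : Tendsto (fun k => u / √(n k)) atTop (𝓝 0) := hsq.const_div_atTop u
    have hW : Tendsto (fun k => (h k : ℂ) + (u / √(n k) : ℝ) * Complex.I) atTop (𝓝 0) := by
      have := ((Complex.continuous_ofReal.tendsto _).comp hh0).add
        (((Complex.continuous_ofReal.tendsto _).comp hφ0).mul_const Complex.I)
      simpa using this
    have hE : Tendsto (fun k => Complex.exp ((h k : ℂ) + (u / √(n k) : ℝ) * Complex.I)) atTop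
        (𝓝 1) := by
      simpa [Function.comp_def] using (Complex.continuous_exp.tendsto 0).comp hW
    have hsmall : ∀ᶠ k in atTop, |u / √(n k)| ≤ δ :=
      (by simpa using hφ0.abs : Tendsto (fun k => |u / √(n k)|) atTop (𝓝 0)).eventually_le_const hδ
    have t1 : Tendsto (fun k => rel (scaleRadius lam (n k) *
        Complex.exp ((h k : ℂ) + (u / √(n k) : ℝ) * Complex.I))) atTop (𝓝 c) := by
      refine hasymp.comp (tendsto_inf.mpr ⟨?_, tendsto_principal.mpr ?_⟩)
      · rw [← tendsto_norm_atTop_iff_cobounded]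
        refine tendsto_atTop_mono' _ ?_ hrad
        filter_upwards [hn.eventually_gt_atTop 0] with k hk
        exact hnorm _ _ _ (scaleRadius_pos hlam hk) (h0 k)
      · filter_upwards [hn.eventually_gt_atTop 0, hsmall] with k hk hs
        exact hsector _ _ _ (scaleRadius_pos hlam hk) hs
    have t2 : Tendsto (fun k => Complex.exp (a * ((h k : ℂ) + (u / √(n k) : ℝ) * Complex.I)))
        atTop (𝓝 1) := by
      simpa [Function.comp_def] using (Complex.continuous_exp.tendsto _).comp (hW.const_mul a)
    have t3 := (Complex.continuous_exp.tendsto _).comp (tendsto_phase hlam hxn h0 h1 u)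
    have t4 := hE.div (hE.sub hw) (sub_ne_zero.mpr hw₀.symm)
    have t := ((t1.mul t2).mul t3).mul t4
    refine Tendsto.congr' ?_ (by convert t using 2; ring)
    filter_upwards [hsmall, hsq.eventually_gt_atTop |u / δ|, hsq.eventually_gt_atTop 0,
      hn.eventually_gt_atTop 0] with k hk hku hs hnk
    have hmem : u ∈ Set.Ioc (-(δ * √(n k))) (δ * √(n k)) := by
      rw [abs_div, abs_of_pos hδ, div_lt_iff₀ hδ, abs_lt] at hku
      constructor <;> nlinarith
    have hφ' := abs_le.mp hk
    simp only [hF, Set.indicator_of_mem hmem, hG]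
    rw [circleKernel_normalized hlam hnk g a _ _ _ (by linarith) (by linarith)]
    simp [hrel]

/-! ### Consequences of the growth hypotheses. -/

/-- Dividing by `M` and not by `c * M` allows `c = 0`, since nothing is assumed about `A`. -/
theorem tendsto_div_of_isEquivalent_const_mul {α : Type*} {l : Filter α} {f M : α → ℂ} {c : ℂ}
    (hf : f ~[l] fun x => c * M x) (hM : ∀ᶠ x in l, M x ≠ 0) :
    Tendsto (fun x => f x / M x) l (𝓝 c) := by
  have h : (f - fun x => c * M x) =o[l] M :=
    hf.isLittleO.trans_isBigO (isBigO_const_mul_self c M l)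
  have := h.tendsto_div_nhds_zero.add_const c
  rw [zero_add] at this
  refine this.congr' ?_
  filter_upwards [hM] with x hx
  simp only [Pi.sub_apply]
  field_simp
  ring

theorem eventually_model_ne_zero (a : ℂ) (lam : ℝ) (s : Set ℂ) :
    ∀ᶠ z in Bornology.cobounded ℂ ⊓ 𝓟 s, z ^ a * Complex.exp (z ^ (lam : ℂ)) ≠ 0 := by
  have : ∀ᶠ z : ℂ in Bornology.cobounded ℂ, z ≠ 0 := by
    have := (tendsto_norm_cobounded_atTop (E := ℂ)).eventually_gt_atTop 0
    filter_upwards [this] with z hz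
    exact norm_pos_iff.mp hz
  filter_upwards [this.filter_mono inf_le_left] with z hz
  exact mul_ne_zero (by simp [Complex.cpow_eq_zero_iff, hz]) (Complex.exp_ne_zero _)

theorem tendsto_mul_sector {ζ : ℂ} (hζ : ζ ≠ 0) (θ : ℝ) :
    Tendsto (fun z => ζ * z) (Bornology.cobounded ℂ ⊓ 𝓟 (closedSector 1 θ))
      (Bornology.cobounded ℂ ⊓ 𝓟 (closedSector ζ θ)) := by
  refine (tendsto_mul_left_cobounded hζ).inf (tendsto_principal_principal.mpr fun z hz => ?_)
  change |Complex.arg (ζ * z / ζ)| ≤ θ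
  change |Complex.arg (z / 1)| ≤ θ at hz
  rwa [mul_div_cancel_left₀ _ hζ, ← div_one z]

theorem tendsto_div_sector {ζ : ℂ} (hζ : ζ ≠ 0) (θ : ℝ) :
    Tendsto (fun z => z / ζ) (Bornology.cobounded ℂ ⊓ 𝓟 (closedSector ζ θ))
      (Bornology.cobounded ℂ ⊓ 𝓟 (closedSector 1 θ)) := by
  simp only [div_eq_mul_inv]
  refine (tendsto_mul_right_cobounded (inv_ne_zero hζ)).inf
    (tendsto_principal_principal.mpr fun z hz => ?_)
  change |Complex.arg (z * ζ⁻¹ / 1)| ≤ θ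
  rwa [div_one, ← div_eq_mul_inv]

namespace HasTwoDirections

variable {f : ℂ → ℂ} {a b A ζ : ℂ} {lam μ θ : ℝ}

theorem tendsto_first (H : HasTwoDirections f a b A ζ lam μ θ) :
    Tendsto (fun z => f z / (z ^ a * Complex.exp (z ^ (lam : ℂ))))
      (Bornology.cobounded ℂ ⊓ 𝓟 (closedSector 1 θ)) (𝓝 1) :=
  tendsto_div_of_isEquivalent_const_mul (by simpa using H.first) (eventually_model_ne_zero a lam _)

/-- A rotation carries the second direction to the positive axis, so that one saddle-point lemma
serves both. -/
theorem tendsto_second (H : HasTwoDirections f a b A ζ lam μ θ) (hζ : ζ ≠ 0) :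
    Tendsto (fun z => f (ζ * z) / (z ^ b * Complex.exp (z ^ (lam : ℂ))))
      (Bornology.cobounded ℂ ⊓ 𝓟 (closedSector 1 θ)) (𝓝 A) := by
  refine tendsto_div_of_isEquivalent_const_mul ?_ (eventually_model_ne_zero b lam _)
  have := H.second.comp_tendsto (tendsto_mul_sector hζ θ)
  simpa [Function.comp_def, mul_div_cancel_left₀ _ hζ, mul_assoc] using this

end HasTwoDirections

theorem norm_cpow_le_rpow_mul_exp (z a : ℂ) :
    ‖z ^ a‖ ≤ ‖z‖ ^ a.re * Real.exp (Real.pi * |a.im|) := by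
  refine (Complex.norm_cpow_le z a).trans ?_
  rw [div_eq_mul_inv, ← Real.exp_neg]
  gcongr
  refine (neg_le_abs _).trans ?_
  rw [abs_mul]
  gcongr
  exact Complex.abs_arg_le_pi z

theorem cpow_ofReal_re {z : ℂ} {lam : ℝ} (hlam : 0 < lam) :
    (z ^ (lam : ℂ)).re = ‖z‖ ^ lam * Real.cos (lam * Complex.arg z) := by
  rcases eq_or_ne z 0 with rfl | hz
  · simp [Complex.zero_cpow (by exact_mod_cast hlam.ne' : (lam : ℂ) ≠ 0), Real.zero_rpow hlam.ne']
  · rw [Complex.cpow_def_of_ne_zero hz, Complex.exp_re, Complex.re_mul_ofReal,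
      Complex.im_mul_ofReal, Complex.log_re, Complex.log_im,
      Real.rpow_def_of_pos (norm_pos_iff.mpr hz), mul_comm lam]

/-- On the compact interval `[δ, θ]` the cosine attains its maximum, and the value `1` is excluded
because `0 < λx < 2π` there. This is how `λθ < 2π` leaves a single direction of maximal growth in
the sector. -/
theorem exists_cos_le {lam θ δ : ℝ} (hlam : 0 < lam) (hδ : 0 < δ) (hone : lam * θ < 2 * Real.pi) :
    ∃ q < 1, ∀ φ : ℝ, δ ≤ |φ| → |φ| ≤ θ → Real.cos (lam * φ) ≤ q := by
  rcases lt_or_ge θ δ with h | h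
  · exact ⟨0, one_pos, fun φ h1 h2 => absurd (h1.trans h2) (not_le.mpr h)⟩
  obtain ⟨x, hx, hmax⟩ := isCompact_Icc.exists_isMaxOn (Set.nonempty_Icc.mpr h)
    (f := fun φ => Real.cos (lam * φ)) (by fun_prop)
  refine ⟨Real.cos (lam * x), lt_of_le_of_ne (Real.cos_le_one _) fun e => ?_, fun φ h1 h2 => ?_⟩
  · have hx0 : 0 < x := hδ.trans_le hx.1
    have : lam * x < 2 * Real.pi := (mul_le_mul_of_nonneg_left hx.2 hlam.le).trans_lt hone
    have hp : 0 < lam * x := by positivity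
    rw [Real.cos_eq_one_iff_of_lt_of_lt (by linarith) this] at e
    exact hp.ne' e
  · have := hmax (show |φ| ∈ Set.Icc δ θ from ⟨h1, h2⟩)
    change Real.cos (lam * |φ|) ≤ _ at this
    rwa [← Real.cos_abs (lam * φ), abs_mul, abs_of_pos hlam]

theorem eventually_const_mul_rpow_le_exp {lam : ℝ} (hlam : 0 < lam) (C s : ℝ) {ε : ℝ}
    (hε : 0 < ε) : ∀ᶠ x : ℝ in atTop, C * x ^ s ≤ Real.exp (ε * x ^ lam) := by
  have h := ((isLittleO_rpow_exp_pos_mul_atTop (s / lam) hε).const_mul_left C).eventuallyLE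
  filter_upwards [(tendsto_rpow_atTop hlam).eventually h, eventually_gt_atTop 0] with x hx hx0
  rw [← Real.rpow_mul hx0.le, mul_div_cancel₀ _ hlam.ne'] at hx
  refine (le_abs_self _).trans (hx.trans_eq ?_)
  rw [Real.norm_of_nonneg (Real.exp_pos _).le]

theorem exists_sector_decay {lam θ δ : ℝ} (hlam : 0 < lam) (hδ : 0 < δ)
    (hone : lam * θ < 2 * Real.pi) {g : ℂ → ℂ} {a c : ℂ}
    (hasymp : Tendsto (fun z => g z / (z ^ a * Complex.exp (z ^ (lam : ℂ))))
      (Bornology.cobounded ℂ ⊓ 𝓟 (closedSector 1 θ)) (𝓝 c)) :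
    ∃ q < 1, ∀ᶠ z in Bornology.cobounded ℂ ⊓ 𝓟 (closedSector 1 θ), δ ≤ |Complex.arg z| →
      ‖g z‖ ≤ Real.exp (q * ‖z‖ ^ lam) := by
  obtain ⟨q, hq, hcos⟩ := exists_cos_le hlam hδ hone
  -- Half of the gap between `q` and `1` is spent on absorbing the constant and the factor `|z| ^ Re
  -- a`.
  refine ⟨(q + 1) / 2, by linarith, ?_⟩
  have h1 := hasymp.norm.eventually_le_const (lt_add_one ‖c‖)
  have h2 := (tendsto_norm_cobounded_atTop (E := ℂ)).eventually
    (eventually_const_mul_rpow_le_exp hlam ((‖c‖ + 1) * Real.exp (Real.pi * |a.im|)) a.re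
      (ε := (1 - q) / 2) (by linarith))
  filter_upwards [h1, h2.filter_mono inf_le_left, eventually_model_ne_zero a lam _,
    (eventually_principal.mpr fun z hz => hz : ∀ᶠ z in 𝓟 (closedSector 1 θ),
      z ∈ closedSector 1 θ).filter_mono inf_le_right] with z hz1 hz2 hz3 hz4 hz5
  have hz6 : |Complex.arg z| ≤ θ := by simpa [closedSector] using hz4
  rw [norm_div, div_le_iff₀ (norm_pos_iff.mpr hz3), norm_mul, Complex.norm_exp,
    cpow_ofReal_re hlam] at hz1
  calc ‖g z‖ ≤ _ := hz1
    _ ≤ (‖c‖ + 1) * (‖z‖ ^ a.re * Real.exp (Real.pi * |a.im|) *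
        Real.exp (‖z‖ ^ lam * q)) := by
      gcongr
      · exact norm_cpow_le_rpow_mul_exp z a
      · exact hcos _ hz5 hz6
    _ = (‖c‖ + 1) * Real.exp (Real.pi * |a.im|) * ‖z‖ ^ a.re * Real.exp (‖z‖ ^ lam * q) := by ring
    _ ≤ Real.exp ((1 - q) / 2 * ‖z‖ ^ lam) * Real.exp (‖z‖ ^ lam * q) := by gcongr
    _ = _ := by
      rw [← Real.exp_add]
      congr 1
      ring

/-- Away from the two directions of maximal growth, the function is exponentially smaller. -/
theorem HasTwoDirections.exists_decay {f : ℂ → ℂ} {a b A ζ : ℂ} {lam μ θ : ℝ}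
    (H : HasTwoDirections f a b A ζ lam μ θ) (hlam : 0 < lam) (hμ : μ < 1) (hζ : ‖ζ‖ = 1)
    (hone : lam * θ < 2 * Real.pi) {δ : ℝ} (hδ : 0 < δ) :
    ∃ q, 0 < q ∧ q < 1 ∧ ∀ᶠ z in Bornology.cobounded ℂ, δ ≤ |Complex.arg z| →
      δ ≤ |Complex.arg (z / ζ)| → ‖f z‖ ≤ Real.exp (q * ‖z‖ ^ lam) := by
  have hζ0 : ζ ≠ 0 := by
    rintro rfl
    simp at hζ
  obtain ⟨q₁, hq₁, h₁⟩ := exists_sector_decay hlam hδ hone H.tendsto_first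
  obtain ⟨q₂, hq₂, h₂⟩ := exists_sector_decay hlam hδ hone (H.tendsto_second hζ0)
  obtain ⟨C, h₃⟩ := H.other.bound
  have h₂' := (tendsto_div_sector hζ0 θ).eventually h₂
  have h₄ := (tendsto_norm_cobounded_atTop (E := ℂ)).eventually
    (eventually_const_mul_rpow_le_exp hlam C 0 (ε := (1 - μ) / 2) (by linarith))
  -- Replacing `μ` by `(μ + 1) / 2` absorbs the constant in the `O`; the entry `1 / 2` only makes
  -- the exponent positive.
  refine ⟨max (max (max q₁ q₂) ((μ + 1) / 2)) (1 / 2), by positivity,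
    max_lt (max_lt (max_lt hq₁ hq₂) (by linarith)) (by norm_num), ?_⟩
  rw [eventually_inf_principal] at h₁ h₂' h₃
  filter_upwards [h₁, h₂', h₃, h₄] with z g₁ g₂ g₃ g₄ hz₁ hz₂
  have mono : ∀ q', q' ≤ max (max (max q₁ q₂) ((μ + 1) / 2)) (1 / 2) →
      ‖f z‖ ≤ Real.exp (q' * ‖z‖ ^ lam) →
      ‖f z‖ ≤ Real.exp (max (max (max q₁ q₂) ((μ + 1) / 2)) (1 / 2) * ‖z‖ ^ lam) := by
    intro q' hq' h
    exact h.trans (by gcongr)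
  by_cases hs₁ : z ∈ closedSector 1 θ
  · exact mono q₁ (by simp) (g₁ hs₁ hz₁)
  by_cases hs₂ : z ∈ closedSector ζ θ
  · refine mono q₂ (by simp) ?_
    have := g₂ hs₂ hz₂
    rwa [mul_div_cancel₀ _ hζ0, norm_div, hζ, div_one] at this
  · refine mono ((μ + 1) / 2) (by simp) ?_
    have := g₃ (by simp [hs₁, hs₂])
    rw [Real.norm_of_nonneg (Real.exp_pos _).le] at this
    rw [Real.rpow_zero, mul_one] at g₄
    calc ‖f z‖ ≤ _ := this
      _ ≤ Real.exp ((1 - μ) / 2 * ‖z‖ ^ lam) * Real.exp (μ * ‖z‖ ^ lam) := by gcongr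
      _ = _ := by
        rw [← Real.exp_add]
        congr 1
        ring

/-! ### The contour: rotation, separation from the zeros, choice of radius. -/

theorem exp_add_sub_mul_I (h φ β : ℝ) :
    Complex.exp (h + (φ - β : ℝ) * Complex.I) =
      Complex.exp (h + φ * Complex.I) / Complex.exp (β * Complex.I) := by
  rw [← Complex.exp_sub]
  congr 1
  push_cast
  ring

theorem exp_add_add_two_pi_mul_I (h φ : ℝ) :
    Complex.exp (h + (φ + 2 * Real.pi : ℝ) * Complex.I) =
      Complex.exp (h + φ * Complex.I) := by
  rw [← Complex.exp_periodic (h + φ * Complex.I)]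
  congr 1
  push_cast
  ring

theorem le_abs_arg_ofReal_mul_exp {r h φ δ : ℝ} (hr : 0 < r) (hδ : 0 < δ) (h1 : δ ≤ φ)
    (h2 : φ ≤ 2 * Real.pi - δ) :
    δ ≤ |Complex.arg (r * Complex.exp (h + φ * Complex.I))| := by
  rcases le_or_gt φ Real.pi with hφ | hφ
  · rw [arg_ofReal_mul_exp hr h (by linarith [Real.pi_pos]) hφ]
    exact h1.trans (le_abs_self _)
  · have := exp_add_add_two_pi_mul_I h (φ - 2 * Real.pi)
    rw [sub_add_cancel] at this
    rw [this, arg_ofReal_mul_exp hr h (by linarith) (by linarith [Real.pi_pos])]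
    refine le_trans ?_ (neg_le_abs _)
    linarith

/-- Moves the saddle at angle `β` to angle `0`; the factor `ζ ^ (-n)` of the second term originates
here. -/
theorem circleKernel_rotate (f : ℂ → ℂ) (n : ℕ) (r h β : ℝ) (z : ℂ) (φ : ℝ) :
    circleKernel f n r h z (φ + β) = (Complex.exp (β * Complex.I) ^ n)⁻¹ *
      circleKernel (fun s => f (Complex.exp (β * Complex.I) * s)) n r h
        (z / Complex.exp (β * Complex.I)) φ := by
  have e : Complex.exp (h + (φ + β : ℝ) * Complex.I) =
      Complex.exp (β * Complex.I) * Complex.exp (h + φ * Complex.I) := by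
    rw [← Complex.exp_add]
    congr 1
    push_cast
    ring
  have e2 : Complex.exp (-(n * (h + (φ + β : ℝ) * Complex.I))) =
      (Complex.exp (β * Complex.I) ^ n)⁻¹ * Complex.exp (-(n * (h + φ * Complex.I))) := by
    rw [← Complex.exp_nat_mul, ← Complex.exp_neg, ← Complex.exp_add]
    congr 1
    push_cast
    ring
  have hβ := Complex.exp_ne_zero (β * Complex.I)
  simp only [circleKernel, e, e2]
  rw [show (r : ℂ) * (Complex.exp (β * Complex.I) * Complex.exp (h + φ * Complex.I)) =
    Complex.exp (β * Complex.I) * (r * Complex.exp (h + φ * Complex.I)) by ring]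
  have e3 : Complex.exp (h + φ * Complex.I) - z / Complex.exp (β * Complex.I) =
      (Complex.exp (β * Complex.I) * Complex.exp (h + φ * Complex.I) - z) /
        Complex.exp (β * Complex.I) := by field_simp
  rw [e3, div_div_eq_mul_div, mul_comm (Complex.exp (h + φ * Complex.I))]
  ring

theorem continuous_circleKernel {f : ℂ → ℂ} (hf : Continuous f) (n : ℕ) (r : ℝ) {h : ℝ} {z : ℂ}
    (hz : ‖z‖ ≠ Real.exp h) : Continuous (circleKernel f n r h z) := by
  unfold circleKernel
  refine Continuous.mul (by fun_prop) (Continuous.div (by fun_prop) (by fun_prop) fun φ => ?_)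
  rw [sub_ne_zero]
  intro e
  apply hz
  rw [← e, norm_exp_add_mul_I]

theorem norm_circleKernel_le {f : ℂ → ℂ} {n : ℕ} {r h d K : ℝ} {z : ℂ} (hh : 0 ≤ h) (h1 : h ≤ 1)
    (hd : 0 < d) (hz : d ≤ |Real.exp h - ‖z‖|) {φ : ℝ}
    (hK : ‖f (r * Complex.exp (h + φ * Complex.I))‖ ≤ K) :
    ‖circleKernel f n r h z φ‖ ≤ K * (Real.exp 1 / d) := by
  unfold circleKernel
  rw [norm_mul, norm_mul, norm_div, norm_exp_add_mul_I]
  have hK0 : 0 ≤ K := (norm_nonneg _).trans hK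
  have b1 : ‖Complex.exp (-(n * (h + φ * Complex.I)))‖ ≤ 1 := by
    rw [Complex.norm_exp, Real.exp_le_one_iff]
    simp
    positivity
  have b2 : d ≤ ‖Complex.exp (h + φ * Complex.I) - z‖ := by
    have := abs_norm_sub_norm_le (Complex.exp (h + φ * Complex.I)) z
    rw [norm_exp_add_mul_I] at this
    exact hz.trans this
  calc _ ≤ K * 1 * (Real.exp 1 / d) := by gcongr
    _ = _ := by ring

/-- With `|W| ≤ D/8`, the bound `|exp W - 1| ≤ 2|W|` gives at most `D/4`; together with `|w - w₀| ≤
D/4` this leaves `D/2` of the distance `D`. -/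
theorem le_norm_exp_sub {h φ δ D : ℝ} {w w₀ : ℂ} (hD : D = ‖1 - w₀‖) (hh : 0 ≤ h) (hhd : h ≤ D / 16)
    (hφ : |φ| ≤ δ) (hδ : δ ≤ D / 16) (h1 : h ≤ 1 / 2) (hδ1 : δ ≤ 1 / 2) (hw : ‖w - w₀‖ ≤ D / 4) :
    D / 2 ≤ ‖Complex.exp (h + φ * Complex.I) - w‖ := by
  have hn : ‖(h + φ * Complex.I : ℂ)‖ ≤ h + δ := by
    refine (norm_add_le _ _).trans ?_
    rw [norm_mul, Complex.norm_I, Complex.norm_real, Complex.norm_real, mul_one,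
      Real.norm_of_nonneg hh]
    exact add_le_add le_rfl hφ
  have he := Complex.norm_exp_sub_one_le (x := h + φ * Complex.I) (by linarith)
  have : ‖1 - w₀‖ ≤ ‖Complex.exp (h + φ * Complex.I) - w‖ + ‖w - w₀‖ +
      ‖Complex.exp (h + φ * Complex.I) - 1‖ := by
    calc ‖1 - w₀‖ = ‖(Complex.exp (h + φ * Complex.I) - w) + (w - w₀) -
          (Complex.exp (h + φ * Complex.I) - 1)‖ := by ring_nf
      _ ≤ _ := (norm_sub_le _ _).trans (by gcongr; exact norm_add_le _ _)
  linarith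

/-- The radius of the contour can be chosen at distance of order `1 / n` from a given modulus. -/
theorem exists_contour_height (x : ℝ) {n : ℕ} (hn : 0 < n) :
    ∃ h : ℝ, 0 ≤ h ∧ h * n ≤ 1 ∧ 1 / (2 * n) ≤ |Real.exp h - x| := by
  have hn' : (0 : ℝ) < n := by exact_mod_cast hn
  -- The radii `1` and `exp (1/n)` are at least `1/n` apart, so `x` cannot be within `1/(2n)` of
  -- both.
  by_cases hx : 1 / (2 * n) ≤ |1 - x|
  · exact ⟨0, le_rfl, by simp, by simpa using hx⟩
  · refine ⟨1 / n, by positivity, by field_simp; rfl, le_trans ?_ (le_abs_self _)⟩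
    have h1 := Real.add_one_le_exp (1 / n : ℝ)
    have h2 := (abs_lt.mp (not_le.mp hx)).1
    have h3 : (1 : ℝ) / n = 1 / (2 * n) + 1 / (2 * n) := by field_simp; norm_num
    linarith

theorem exists_arg_mem_Ioo {ζ : ℂ} (hζ : ‖ζ‖ = 1) (hζ1 : ζ ≠ 1) :
    ∃ β : ℝ, 0 < β ∧ β < 2 * Real.pi ∧ Complex.exp (β * Complex.I) = ζ := by
  have e : Complex.exp (Complex.arg ζ * Complex.I) = ζ := by
    have := Complex.norm_mul_exp_arg_mul_I ζ
    rwa [hζ, Complex.ofReal_one, one_mul] at this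
  have h0 : Complex.arg ζ ≠ 0 := by
    intro h
    rw [h] at e
    simp at e
    exact hζ1 e.symm
  have hl := Complex.neg_pi_lt_arg ζ
  have hu := Complex.arg_le_pi ζ
  rcases lt_or_gt_of_ne h0 with h | h
  · refine ⟨Complex.arg ζ + 2 * Real.pi, by linarith, by linarith, Eq.trans ?_ e⟩
    have := exp_add_add_two_pi_mul_I 0 (Complex.arg ζ)
    simpa using this
  · exact ⟨Complex.arg ζ, h, by linarith [Real.pi_pos], e⟩

/-! ### The two-saddle asymptotics of the remainder. -/

/-- The remainder integral, divided by the size of the integrand at the saddle points. -/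
noncomputable def scaledRemainder (f : ℂ → ℂ) (lam : ℝ) (n : ℕ) (h : ℝ) (z : ℂ) : ℂ :=
  (√n * Complex.exp (-(n / lam : ℝ)) : ℂ) *
    ∫ φ in (0 : ℝ)..(2 * Real.pi), circleKernel f n (scaleRadius lam n) h z φ

theorem tendsto_rpow_mul_rpow_mul_exp {lam : ℝ} (hlam : 0 < lam) (p s : ℝ) {ε : ℝ} (hε : 0 < ε) {n : ℕ → ℕ}
    (hn : Tendsto n atTop atTop) :
    Tendsto (fun k => scaleRadius lam (n k) ^ p *
      ((n k : ℝ) ^ s * Real.exp (-(ε * n k)))) atTop (𝓝 0) := by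
  have h := (tendsto_rpow_mul_exp_neg_mul_atTop_nhds_zero (p / lam + s) ε hε).comp
    (tendsto_natCast_atTop_atTop.comp hn)
  have := h.const_mul ((1 / lam) ^ (p / lam))
  rw [mul_zero] at this
  refine this.congr' ?_
  filter_upwards [hn.eventually_gt_atTop 0] with k hk
  have hk' : (0 : ℝ) < n k := by exact_mod_cast hk
  simp only [Function.comp, scaleRadius]
  rw [← Real.rpow_mul (by positivity), one_div_mul_eq_div, Real.rpow_add hk', div_eq_mul_one_div (n k : ℝ) lam,
    Real.mul_rpow hk'.le (by positivity), neg_mul]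
  ring

/-- The circle is cut into arcs of half-width `δ` about the angles `0` and `β` of the two saddles,
handled by Laplace's method, and two complementary arcs, where `f` is exponentially smaller. The
error beats every power of the radius, hence is negligible whatever `a` and `b` are. -/
theorem HasTwoDirections.scaledRemainder_asymptotics {f : ℂ → ℂ} {a b A ζ : ℂ} {lam μ θ : ℝ}
    (H : HasTwoDirections f a b A ζ lam μ θ) (hf : Continuous f) (hlam : 0 < lam) (hμ : μ < 1)
    (hζ : ‖ζ‖ = 1) (hζ1 : ζ ≠ 1) (hθ : 0 < θ) (hone : lam * θ < 2 * Real.pi)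
    {n : ℕ → ℕ} (hn : Tendsto n atTop atTop) {h : ℕ → ℝ} (h0 : ∀ k, 0 ≤ h k)
    (h1 : ∀ k, h k * n k ≤ 1) {z : ℕ → ℂ} {z₀ : ℂ} (hz : Tendsto z atTop (𝓝 z₀)) (hz1 : z₀ ≠ 1)
    (hzζ : z₀ ≠ ζ) (hdist : ∀ᶠ k in atTop, 1 / (2 * n k : ℝ) ≤ |Real.exp (h k) - ‖z k‖|) :
    ∃ u v e : ℕ → ℂ,
      (∀ᶠ k in atTop, scaledRemainder f lam (n k) (h k) (z k) =
        (scaleRadius lam (n k) : ℂ) ^ a * u k +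
          (scaleRadius lam (n k) : ℂ) ^ b * (ζ ^ n k)⁻¹ * v k + e k) ∧
      Tendsto u atTop (𝓝 (√(2 * Real.pi / lam) * (1 / (1 - z₀)))) ∧
      Tendsto v atTop (𝓝 (√(2 * Real.pi / lam) * (A / (1 - z₀ / ζ)))) ∧
      ∀ p : ℝ, Tendsto (fun k => scaleRadius lam (n k) ^ p * ‖e k‖) atTop (𝓝 0) := by
  obtain ⟨β, hβ0, hβ2, hβ⟩ := exists_arg_mem_Ioo hζ hζ1
  have hζ0 : ζ ≠ 0 := by
    rintro rfl
    simp at hζ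
  have hD₁ : 0 < ‖1 - z₀‖ := norm_pos_iff.mpr (sub_ne_zero.mpr hz1.symm)
  have hw₀ : z₀ / ζ ≠ 1 := by rwa [Ne, div_eq_one_iff_eq hζ0]
  have hD₂ : 0 < ‖1 - z₀ / ζ‖ := norm_pos_iff.mpr (sub_ne_zero.mpr hw₀.symm)
  have hpi := Real.pi_pos
  -- The bounds on `2 * δ` keep the two arcs disjoint on the circle; those with `16` serve
  -- `le_norm_exp_sub`.
  obtain ⟨δ, hδ, d1, d2, d3, d4, d5, d6, d7⟩ : ∃ δ : ℝ, 0 < δ ∧ δ ≤ θ ∧ δ ≤ 1 / 2 ∧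
      lam * δ ≤ Real.pi ∧ 2 * δ < β ∧ 2 * δ < 2 * Real.pi - β ∧ δ ≤ ‖1 - z₀‖ / 16 ∧
      δ ≤ ‖1 - z₀ / ζ‖ / 16 := by
    have t0 : Tendsto (fun δ : ℝ => δ) (𝓝[>] 0) (𝓝 0) := nhdsWithin_le_nhds
    have ev : ∀ c : ℝ, 0 < c → ∀ᶠ δ in 𝓝[>] (0 : ℝ), δ < c := fun c hc => t0.eventually_lt_const hc
    have hp : ∀ᶠ δ in 𝓝[>] (0 : ℝ), 0 < δ := eventually_mem_nhdsWithin
    obtain ⟨δ, e0, e1, e2, e3, e4, e5, e6, e7⟩ := (hp.and ((ev θ hθ).and ((ev (1 / 2) (by norm_num)).and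
      ((ev (Real.pi / lam) (by positivity)).and ((ev (β / 2) (by positivity)).and
      ((ev ((2 * Real.pi - β) / 2) (by linarith)).and ((ev (‖1 - z₀‖ / 16) (by positivity)).and
      (ev (‖1 - z₀ / ζ‖ / 16) (by positivity))))))))).exists
    refine ⟨δ, e0, e1.le, e2.le, ?_, by linarith, by linarith, e6.le, e7.le⟩
    rw [lt_div_iff₀ hlam] at e3
    linarith
  have hδπ : δ < Real.pi := by linarith [Real.pi_gt_three]
  have hxn : Tendsto (fun k => (n k : ℝ)) atTop atTop := tendsto_natCast_atTop_atTop.comp hn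
  have hh0 : Tendsto h atTop (𝓝 0) := tendsto_height hxn h0 h1
  have hsep : ∀ {w : ℕ → ℂ} {w₀ : ℂ}, Tendsto w atTop (𝓝 w₀) → 0 < ‖1 - w₀‖ →
      δ ≤ ‖1 - w₀‖ / 16 → ∀ᶠ k in atTop, ∀ φ : ℝ, |φ| ≤ δ →
        ‖1 - w₀‖ / 2 ≤ ‖Complex.exp (h k + φ * Complex.I) - w k‖ := by
    intro w w₀ hw hpos hδ'
    have hw' := (tendsto_iff_norm_sub_tendsto_zero.mp hw).eventually_le_const
      (show 0 < ‖1 - w₀‖ / 4 by positivity)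
    filter_upwards [hw', hh0.eventually_le_const (show 0 < ‖1 - w₀‖ / 16 by positivity),
      hh0.eventually_le_const (show (0 : ℝ) < 1 / 2 by norm_num)] with k k1 k2 k3 φ hφ
    exact le_norm_exp_sub rfl (h0 k) k2 hφ hδ' k3 d2 k1
  have hzζt : Tendsto (fun k => z k / ζ) atTop (𝓝 (z₀ / ζ)) := hz.div_const ζ
  have T₁ := tendsto_integral_circleKernel hlam hδ d1 hδπ d3 hf H.tendsto_first hn h0 h1 hz hz1
    (half_pos hD₁) (hsep hz hD₁ d6)
  have T₂ := tendsto_integral_circleKernel hlam hδ d1 hδπ d3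
    (show Continuous fun s => f (ζ * s) by fun_prop) (H.tendsto_second hζ0) hn h0 h1 hzζt hw₀
    (half_pos hD₂) (hsep hzζt hD₂ d7)
  set κ : ℕ → ℝ → ℂ := fun k => circleKernel f (n k) (scaleRadius lam (n k)) (h k) (z k) with hκ
  refine ⟨_, _, fun k => (√(n k) * Complex.exp (-(n k / lam : ℝ)) : ℂ) *
    ((∫ φ in δ..(β - δ), κ k φ) + ∫ φ in (β + δ)..(2 * Real.pi - δ), κ k φ), ?_, T₁, T₂, ?_⟩
  · filter_upwards [hdist, hn.eventually_gt_atTop 0] with k hk hnk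
    have hnk' : (0 : ℝ) < n k := by exact_mod_cast hnk
    have hne : ‖z k‖ ≠ Real.exp (h k) := by
      intro e
      rw [e, sub_self, abs_zero] at hk
      have : 0 < 1 / (2 * n k : ℝ) := by positivity
      linarith
    have hc : Continuous (κ k) := continuous_circleKernel hf _ _ hne
    have hper : Function.Periodic (κ k) (2 * Real.pi) := by
      intro φ
      simp only [hκ, circleKernel, exp_add_add_two_pi_mul_I]
      congr 2
      rw [Complex.exp_eq_exp_iff_exists_int]
      refine ⟨-(n k), ?_⟩
      push_cast
      ring
    have hs : (∫ φ in (0 : ℝ)..(2 * Real.pi), κ k φ) = (∫ φ in (-δ)..δ, κ k φ) +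
        (∫ φ in δ..(β - δ), κ k φ) + (∫ φ in (β - δ)..(β + δ), κ k φ) +
        ∫ φ in (β + δ)..(2 * Real.pi - δ), κ k φ := by
      have := hper.intervalIntegral_add_eq 0 (-δ)
      rw [zero_add, neg_add_eq_sub] at this
      rw [this, intervalIntegral.integral_add_adjacent_intervals,
        intervalIntegral.integral_add_adjacent_intervals,
        intervalIntegral.integral_add_adjacent_intervals] <;>
        exact hc.intervalIntegrable _ _
    have hrot : (∫ φ in (β - δ)..(β + δ), κ k φ) = (ζ ^ n k)⁻¹ *
        ∫ φ in (-δ)..δ, circleKernel (fun s => f (ζ * s)) (n k) (scaleRadius lam (n k)) (h k)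
          (z k / ζ) φ := by
      rw [← intervalIntegral.integral_const_mul]
      have := intervalIntegral.integral_comp_add_right (a := -δ) (b := δ) (κ k) β
      rw [neg_add_eq_sub, add_comm δ β] at this
      rw [← this]
      refine intervalIntegral.integral_congr fun φ _ => ?_
      simp only [hκ]
      rw [circleKernel_rotate, hβ]
    have hr := scaleRadius_pos hlam hnk
    have hrC : (scaleRadius lam (n k) : ℂ) ≠ 0 := by exact_mod_cast hr.ne'
    have hra : (scaleRadius lam (n k) : ℂ) ^ a ≠ 0 := by simp [Complex.cpow_eq_zero_iff, hrC]
    have hrb : (scaleRadius lam (n k) : ℂ) ^ b ≠ 0 := by simp [Complex.cpow_eq_zero_iff, hrC]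
    rw [scaledRemainder, show (∫ φ in (0 : ℝ)..(2 * Real.pi), circleKernel f (n k)
      (scaleRadius lam (n k)) (h k) (z k) φ) = ∫ φ in (0 : ℝ)..(2 * Real.pi), κ k φ from rfl, hs,
      hrot, Complex.cpow_neg, Complex.cpow_neg]
    field_simp
    ring
  · intro p
    obtain ⟨q, hq0, hq1, hq⟩ := H.exists_decay hlam hμ hζ hone hδ
    -- The power `n²` comes from `√n ≤ n` and from the Cauchy factor, which is `O(n)` at distance
    -- `1/(2n)`. The rate is what remains after `q` is raised to `(1 + q) / 2` to absorb `exp (λ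
    -- h)`.
    have hlim := (tendsto_rpow_mul_rpow_mul_exp hlam p 2 (ε := (1 - q) / (2 * lam))
      (div_pos (by linarith) (by positivity)) hn).const_mul (8 * Real.pi * Real.exp 1)
    rw [mul_zero] at hlim
    refine squeeze_zero' ?_ ?_ hlim
    · filter_upwards [hn.eventually_gt_atTop 0] with k hk
      have := scaleRadius_pos hlam hk
      positivity
    obtain ⟨R, hR⟩ : ∃ R : ℝ, ∀ z : ℂ, R ≤ ‖z‖ → δ ≤ |Complex.arg z| →
        δ ≤ |Complex.arg (z / ζ)| → ‖f z‖ ≤ Real.exp (q * ‖z‖ ^ lam) := by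
      rw [← comap_norm_atTop, eventually_comap] at hq
      obtain ⟨R, hR⟩ := eventually_atTop.mp hq
      exact ⟨R, fun z hz => hR _ hz z rfl⟩
    have hexp : Tendsto (fun k => q * Real.exp (lam * h k)) atTop (𝓝 q) := by
      have := ((Real.continuous_exp.tendsto _).comp (hh0.const_mul lam)).const_mul q
      simpa [Function.comp_def] using this
    filter_upwards [hdist, hn.eventually_gt_atTop 0, hh0.eventually_le_const one_pos,
      ((tendsto_scaleRadius hlam).comp hn).eventually_ge_atTop R,
      hexp.eventually_le_const (show q < (1 + q) / 2 by linarith)] with k hk hnk hk1 hkR hkq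
    have hnk' : (0 : ℝ) < n k := by exact_mod_cast hnk
    have hnk1 : (1 : ℝ) ≤ n k := by exact_mod_cast hnk
    have hr := scaleRadius_pos hlam hnk
    have hbound : ∀ φ, δ ≤ φ → φ ≤ 2 * Real.pi - δ → (φ ≤ β - δ ∨ β + δ ≤ φ) →
        ‖κ k φ‖ ≤ Real.exp ((1 + q) / 2 * (n k / lam)) * (Real.exp 1 / (1 / (2 * n k))) := by
      intro φ g1 g2 g3
      refine norm_circleKernel_le (h0 k) hk1 (by positivity) hk ?_
      have hnorm : ‖(scaleRadius lam (n k) : ℂ) * Complex.exp (h k + φ * Complex.I)‖ =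
          scaleRadius lam (n k) * Real.exp (h k) := by
        rw [norm_mul, norm_exp_add_mul_I, Complex.norm_real, Real.norm_of_nonneg hr.le]
      refine (hR _ ?_ (le_abs_arg_ofReal_mul_exp hr hδ g1 g2) ?_).trans ?_
      · rw [hnorm]
        exact hkR.trans (le_mul_of_one_le_right hr.le (Real.one_le_exp (h0 k)))
      · rw [← hβ, mul_div_assoc, ← exp_add_sub_mul_I]
        rcases g3 with g3 | g3
        · rw [← exp_add_add_two_pi_mul_I]
          exact le_abs_arg_ofReal_mul_exp hr hδ (by linarith) (by linarith)
        · exact le_abs_arg_ofReal_mul_exp hr hδ (by linarith) (by linarith)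
      · rw [hnorm, Real.mul_rpow hr.le (Real.exp_pos _).le, scaleRadius_rpow hlam,
          ← Real.exp_mul, mul_comm (h k)]
        refine Real.exp_le_exp.mpr ?_
        calc q * (n k / lam * Real.exp (lam * h k)) = q * Real.exp (lam * h k) * (n k / lam) := by
              ring
          _ ≤ _ := by gcongr
    set K := Real.exp ((1 + q) / 2 * (n k / lam)) * (Real.exp 1 / (1 / (2 * n k))) with hK
    have hK0 : 0 ≤ K := by positivity
    have i1 : ‖∫ φ in δ..(β - δ), κ k φ‖ ≤ K * (2 * Real.pi) := by
      refine (intervalIntegral.norm_integral_le_of_norm_le_const fun φ hφ => ?_).trans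
        (mul_le_mul_of_nonneg_left (b := |β - δ - δ|) ?_ hK0)
      · rw [Set.uIoc_of_le (by linarith)] at hφ
        exact hbound φ hφ.1.le (by linarith [hφ.2]) (Or.inl hφ.2)
      · rw [abs_of_nonneg (by linarith)]
        linarith
    have i2 : ‖∫ φ in (β + δ)..(2 * Real.pi - δ), κ k φ‖ ≤ K * (2 * Real.pi) := by
      refine (intervalIntegral.norm_integral_le_of_norm_le_const fun φ hφ => ?_).trans
        (mul_le_mul_of_nonneg_left (b := |2 * Real.pi - δ - (β + δ)|) ?_ hK0)
      · rw [Set.uIoc_of_le (by linarith)] at hφ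
        exact hbound φ (by linarith [hφ.1]) hφ.2 (Or.inr hφ.1.le)
      · rw [abs_of_nonneg (by linarith)]
        linarith
    have hsqrt : √(n k : ℝ) ≤ n k := by
      rw [Real.sqrt_le_left hnk'.le]
      nlinarith
    have hn2 : ‖(√(n k) * Complex.exp (-(n k / lam : ℝ)) : ℂ)‖ ≤
        n k * Real.exp (-(n k / lam)) := by
      rw [norm_mul, Complex.norm_real, Real.norm_of_nonneg (Real.sqrt_nonneg _),
        ← Complex.ofReal_neg, Complex.norm_exp_ofReal]
      gcongr
    rw [norm_mul]
    have hsum := (norm_add_le (∫ φ in δ..(β - δ), κ k φ)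
      (∫ φ in (β + δ)..(2 * Real.pi - δ), κ k φ)).trans (add_le_add i1 i2)
    have hee : Real.exp ((1 + q) / 2 * (n k / lam)) * Real.exp (-(n k / lam)) =
        Real.exp (-((1 - q) / (2 * lam) * n k)) := by
      rw [← Real.exp_add]
      congr 1
      field_simp
      ring
    calc _ ≤ scaleRadius lam (n k) ^ p * (n k * Real.exp (-(n k / lam)) *
          (K * (2 * Real.pi) + K * (2 * Real.pi))) := by gcongr
      _ = _ := by
        rw [hK, ← hee, Real.rpow_two]
        field_simp
        ring

/-! ### The modulus defining the curve, and the remainder at a zero. -/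

theorem ofReal_mul_cpow {r : ℝ} (hr : 0 < r) {z : ℂ} (hz : z ≠ 0) (a : ℂ) :
    ((r : ℂ) * z) ^ a = (r : ℂ) ^ a * z ^ a := by
  have hrC : (r : ℂ) ≠ 0 := by exact_mod_cast hr.ne'
  rw [Complex.cpow_def_of_ne_zero (mul_ne_zero hrC hz), Complex.log_ofReal_mul hr hz,
    Complex.cpow_def_of_ne_zero hrC, Complex.cpow_def_of_ne_zero hz, Complex.ofReal_log hr.le,
    add_mul, Complex.exp_add]

theorem szegoModulus_eq (lam : ℝ) {z : ℂ} (hz : z ≠ 0) :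
    szegoModulus lam z = ‖z‖ ^ lam * Real.exp (1 - (z ^ (lam : ℂ)).re) := by
  rw [szegoModulus, norm_mul, Complex.norm_exp, Complex.sub_re, Complex.one_re,
    Complex.norm_cpow_of_ne_zero hz]
  simp

theorem szegoModulus_pos (lam : ℝ) {z : ℂ} (hz : z ≠ 0) :
    0 < szegoModulus lam z := by
  rw [szegoModulus_eq lam hz]
  have := norm_pos_iff.mpr hz
  positivity

theorem mem_slitPlane_of_abs_arg_lt {z : ℂ} (hz : z ≠ 0) (h : |Complex.arg z| < Real.pi) :
    z ∈ Complex.slitPlane := by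
  rw [Complex.mem_slitPlane_iff_arg]
  exact ⟨(abs_lt.mp h).2.ne, hz⟩

theorem continuousAt_szegoModulus (lam : ℝ) {z : ℂ} (hz : z ∈ Complex.slitPlane) :
    ContinuousAt (szegoModulus lam) z := by
  unfold szegoModulus
  have h : ContinuousAt (fun z : ℂ => z ^ (lam : ℂ)) z := continuousAt_cpow_const hz
  exact (h.mul (Complex.continuous_exp.continuousAt.comp (continuousAt_const.sub h))).norm

/-- On the unit circle, inside the sector, the modulus exceeds `1` except at the corner. -/
theorem eq_one_of_norm_eq_one {lam θ : ℝ} (hlam : 0 < lam) (hone : lam * θ < 2 * Real.pi)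
    {z : ℂ} (harg : |Complex.arg z| < θ) (hz : ‖z‖ = 1) (hM : szegoModulus lam z ≤ 1) : z = 1 := by
  have hz0 : z ≠ 0 := by
    rintro rfl
    simp at hz
  -- On the unit circle the modulus is `exp (1 - cos (λ arg z))`.
  rw [szegoModulus_eq lam hz0, cpow_ofReal_re hlam, hz, Real.one_rpow, one_mul, one_mul,
    Real.exp_le_one_iff] at hM
  have hc : Real.cos (lam * Complex.arg z) = 1 := le_antisymm (Real.cos_le_one _) (by linarith)
  have hb : |lam * Complex.arg z| < 2 * Real.pi := by
    rw [abs_mul, abs_of_pos hlam]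
    exact (mul_lt_mul_of_pos_left harg hlam).trans hone
  rw [Real.cos_eq_one_iff_of_lt_of_lt (abs_lt.mp hb).1 (abs_lt.mp hb).2] at hc
  have h0 : Complex.arg z = 0 := (mul_eq_zero.mp hc).resolve_left hlam.ne'
  have := Complex.norm_mul_exp_arg_mul_I z
  rw [hz, h0] at this
  simpa using this.symm

/-- The size of the remainder integral at a zero of the partial sum. -/
theorem HasTwoDirections.norm_scaledRemainder_at_zeros {f : ℂ → ℂ} {a b A ζ : ℂ} {lam μ θ : ℝ}
    (H : HasTwoDirections f a b A ζ lam μ θ) (hf : Differentiable ℂ f) (hlam : 0 < lam)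
    (hθπ : θ < Real.pi) {n : ℕ → ℕ} {z : ℕ → ℂ} {z₀ : ℂ} (hz₀ : z₀ ≠ 0)
    (harg : |Complex.arg z₀| < θ) (Z : ZerosTendTo f lam n z z₀) {h : ℕ → ℝ}
    (hdist : ∀ᶠ k in atTop, ‖z k‖ ≠ Real.exp (h k)) :
    ∃ c : ℕ → ℝ, (∃ c₀ > 0, Tendsto c atTop (𝓝 c₀)) ∧
      ∀ᶠ k in atTop, ‖scaledRemainder f lam (n k) (h k) (z k)‖ =
        if ‖z k‖ < Real.exp (h k) then
          c k * √(n k) * scaleRadius lam (n k) ^ a.re * szegoModulus lam (z k) ^ (-(n k / lam : ℝ))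
        else 0 := by
  obtain ⟨hn, hzero, hz⟩ := Z
  have hslit := mem_slitPlane_of_abs_arg_lt hz₀ (harg.trans hθπ)
  have hrad := (tendsto_scaleRadius hlam).comp hn
  have hnz : ∀ᶠ k in atTop, z k ≠ 0 := hz.eventually_ne hz₀
  have hratio : Tendsto (fun k => (fun s => f s / (s ^ a * Complex.exp (s ^ (lam : ℂ))))
      ((scaleRadius lam (n k) : ℂ) * z k)) atTop (𝓝 1) := by
    refine H.tendsto_first.comp (tendsto_inf.mpr ⟨?_, tendsto_principal.mpr ?_⟩)
    · rw [← tendsto_norm_atTop_iff_cobounded]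
      refine (hrad.atTop_mul_pos (norm_pos_iff.mpr hz₀) hz.norm).congr' ?_
      filter_upwards [hrad.eventually_gt_atTop 0] with k hk
      rw [Function.comp] at hk ⊢
      rw [norm_mul, Complex.norm_real, Real.norm_of_nonneg hk.le]
    · have : Tendsto (fun k => |Complex.arg (z k)|) atTop (𝓝 |Complex.arg z₀|) :=
        ((Complex.continuousAt_arg hslit).tendsto.comp hz).abs
      filter_upwards [this.eventually_lt_const harg, hrad.eventually_gt_atTop 0] with k hk hk0
      change |Complex.arg _| ≤ θ
      rw [div_one, Complex.arg_real_mul _ (show 0 < scaleRadius lam (n k) from hk0)]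
      exact hk.le
  have hza : Tendsto (fun k => z k ^ a) atTop (𝓝 (z₀ ^ a)) :=
    (continuousAt_cpow_const hslit).tendsto.comp hz
  -- Here `c k` is `2π` times the modulus of the ratio of `f` to its model times `|z k ^ a|`, so its
  -- limit is `2π |z₀ ^ a|`.
  refine ⟨_, ⟨_, ?_, (hratio.norm.mul hza.norm).const_mul (2 * Real.pi)⟩, ?_⟩
  · have : z₀ ^ a ≠ 0 := by simp [Complex.cpow_eq_zero_iff, hz₀]
    have := norm_pos_iff.mpr this
    have := Real.pi_pos
    rw [norm_one]
    positivity
  filter_upwards [hdist, hzero, hn.eventually_gt_atTop 0, hnz] with k hk hk0 hnk hzk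
  have hr := scaleRadius_pos hlam hnk
  have hrC : (scaleRadius lam (n k) : ℂ) ≠ 0 := by exact_mod_cast hr.ne'
  have key := integral_circleKernel hf (n k) hr (h k) hk
  -- For `n k > 0`, the polynomial of index `n k - 1` is exactly the sum over `range (n k)` in the
  -- remainder formula.
  rw [maclaurinSum, Nat.sub_add_cancel hnk] at hk0
  rw [hk0, sub_zero] at key
  have hzp : 0 < ‖z k‖ := norm_pos_iff.mpr hzk
  have key2 := congrArg norm key
  rw [norm_mul, norm_pow, norm_mul, norm_mul, Complex.norm_real, Complex.norm_two,
    Real.norm_of_nonneg Real.pi_pos.le] at key2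
  have hE : ‖scaledRemainder f lam (n k) (h k) (z k)‖ = √(n k) * Real.exp (-(n k / lam)) *
      ‖∫ φ in (0 : ℝ)..(2 * Real.pi), circleKernel f (n k) (scaleRadius lam (n k)) (h k) (z k) φ‖ := by
    rw [scaledRemainder, norm_mul, norm_mul, Complex.norm_real,
      Real.norm_of_nonneg (Real.sqrt_nonneg _), ← Complex.ofReal_neg, Complex.norm_exp_ofReal]
  rw [hE]
  split_ifs with hlt
  · rw [if_pos hlt] at key2
    set ρ := f ((scaleRadius lam (n k) : ℂ) * z k) / (((scaleRadius lam (n k) : ℂ) * z k) ^ a *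
      Complex.exp (((scaleRadius lam (n k) : ℂ) * z k) ^ (lam : ℂ))) with hρ
    have hfe : ‖f (scaleRadius lam (n k) * z k)‖ = ‖ρ‖ * ((scaleRadius lam (n k)) ^ a.re *
        ‖z k ^ a‖ * Real.exp (n k / lam * (z k ^ (lam : ℂ)).re)) := by
      have hm : ((scaleRadius lam (n k) : ℂ) * z k) ^ a *
          Complex.exp (((scaleRadius lam (n k) : ℂ) * z k) ^ (lam : ℂ)) ≠ 0 :=
        mul_ne_zero (by simp [Complex.cpow_eq_zero_iff, hrC, hzk]) (Complex.exp_ne_zero _)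
      have e1 : ‖((scaleRadius lam (n k) : ℂ) * z k) ^ a *
          Complex.exp (((scaleRadius lam (n k) : ℂ) * z k) ^ (lam : ℂ))‖ =
          (scaleRadius lam (n k)) ^ a.re *
            ‖z k ^ a‖ * Real.exp (n k / lam * (z k ^ (lam : ℂ)).re) := by
        rw [norm_mul, ofReal_mul_cpow hr hzk, ofReal_mul_cpow hr hzk, norm_mul,
          Complex.norm_cpow_eq_rpow_re_of_pos hr, Complex.norm_exp, ← Complex.ofReal_cpow hr.le,
          scaleRadius_rpow hlam, Complex.re_ofReal_mul]
      rw [← e1, ← norm_mul, hρ, div_mul_cancel₀ _ hm]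
    -- The factor `|z| ^ (-n)` from the kernel, the exponential growth of `f` and the normalization
    -- `exp (-n/λ)` combine into a single power of the modulus.
    have hM : szegoModulus lam (z k) ^ (-(n k / lam : ℝ)) =
        (‖z k‖ ^ n k)⁻¹ * (Real.exp (n k / lam * (z k ^ (lam : ℂ)).re) *
          Real.exp (-(n k / lam))) := by
      rw [szegoModulus_eq lam hzk, Real.mul_rpow (by positivity) (Real.exp_pos _).le,
        ← Real.rpow_mul hzp.le, ← Real.exp_mul, ← Real.exp_add]
      congr 1
      · rw [show lam * -(n k / lam) = -(n k : ℝ) by field_simp, Real.rpow_neg hzp.le,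
          Real.rpow_natCast]
      · congr 1
        ring
    have hI : ‖∫ φ in (0 : ℝ)..(2 * Real.pi),
        circleKernel f (n k) (scaleRadius lam (n k)) (h k) (z k) φ‖ =
        (‖z k‖ ^ n k)⁻¹ * (2 * Real.pi * ‖f (scaleRadius lam (n k) * z k)‖) := by
      rw [← key2]
      field_simp
    rw [hI, hfe, hM]
    ring
  · rw [if_neg hlt, norm_zero, mul_zero] at key2
    rw [(mul_eq_zero.mp key2).resolve_left (by positivity), mul_zero]

/-! ### The size of a sum of two oscillating terms. -/

section size

variable {r : ℕ → ℝ} {a b ζ U V : ℂ} {n : ℕ → ℕ} {E u v e : ℕ → ℂ}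

/-- After division by the larger power only dominant terms survive, both of them when the exponents
agree. -/
theorem exists_tendsto_rpow_sub_max (hr : Tendsto r atTop atTop) (s t : ℝ) :
    Tendsto (fun k => r k ^ (s - max s t)) atTop (𝓝 (if t ≤ s then 1 else 0)) := by
  split_ifs with h
  · simp [max_eq_left h]
  · rw [max_eq_right (not_le.mp h).le, ← neg_sub]
    exact (tendsto_rpow_neg_atTop (sub_pos.mpr (not_le.mp h))).comp hr

theorem tendsto_mul_rpow_sub_max (hr : Tendsto r atTop atTop) (hu : Tendsto u atTop (𝓝 U))
    (s t : ℝ) : Tendsto (fun k => r k ^ (s - max s t) * ‖u k‖) atTop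
      (𝓝 ((if t ≤ s then 1 else 0) * ‖U‖)) :=
  (exists_tendsto_rpow_sub_max hr s t).mul hu.norm

theorem norm_two_terms_bounds (hζ : ‖ζ‖ = 1) {ρ : ℝ} (hρ : 0 < ρ) {N : ℕ} {F x y w : ℂ} (s : ℝ)
    (hF : F = (ρ : ℂ) ^ a * x + (ρ : ℂ) ^ b * (ζ ^ N)⁻¹ * y + w) :
    ρ ^ (-s) * ‖F‖ ≤ ρ ^ (a.re - s) * ‖x‖ + ρ ^ (b.re - s) * ‖y‖ + ρ ^ (-s) * ‖w‖ ∧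
    |ρ ^ (a.re - s) * ‖x‖ - ρ ^ (b.re - s) * ‖y‖| - ρ ^ (-s) * ‖w‖ ≤ ρ ^ (-s) * ‖F‖ := by
  have n1 : ‖(ρ : ℂ) ^ a * x‖ = ρ ^ a.re * ‖x‖ := by
    rw [norm_mul, Complex.norm_cpow_eq_rpow_re_of_pos hρ]
  have n2 : ‖(ρ : ℂ) ^ b * (ζ ^ N)⁻¹ * y‖ = ρ ^ b.re * ‖y‖ := by
    rw [norm_mul, norm_mul, Complex.norm_cpow_eq_rpow_re_of_pos hρ, norm_inv, norm_pow, hζ]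
    simp
  have hs : 0 < ρ ^ (-s) := by positivity
  have p1 : ρ ^ (a.re - s) * ‖x‖ = ρ ^ (-s) * (ρ ^ a.re * ‖x‖) := by
    rw [sub_eq_neg_add, Real.rpow_add hρ, mul_assoc]
  have p2 : ρ ^ (b.re - s) * ‖y‖ = ρ ^ (-s) * (ρ ^ b.re * ‖y‖) := by
    rw [sub_eq_neg_add, Real.rpow_add hρ, mul_assoc]
  rw [p1, p2, ← n1, ← n2]
  constructor
  · rw [← mul_add, ← mul_add, hF]
    gcongr
    exact norm_add₃_le
  · rw [← mul_sub, abs_mul, abs_of_pos hs, ← mul_sub]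
    gcongr
    set X := (ρ : ℂ) ^ a * x
    set Y := (ρ : ℂ) ^ b * (ζ ^ N)⁻¹ * y
    have h1 := abs_norm_sub_norm_le X (-Y)
    rw [norm_neg, sub_neg_eq_add] at h1
    have h2 := norm_sub_le (X + Y + w) w
    rw [add_sub_cancel_right] at h2
    rw [hF]
    linarith

theorem exists_norm_le_rpow_max (hζ : ‖ζ‖ = 1) (hr : Tendsto r atTop atTop)
    (hE : ∀ᶠ k in atTop, E k = (r k : ℂ) ^ a * u k + (r k : ℂ) ^ b * (ζ ^ n k)⁻¹ * v k + e k)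
    (hu : Tendsto u atTop (𝓝 U)) (hv : Tendsto v atTop (𝓝 V))
    (he : ∀ p : ℝ, Tendsto (fun k => r k ^ p * ‖e k‖) atTop (𝓝 0)) :
    ∃ C > 0, ∀ᶠ k in atTop, r k ^ (-max a.re b.re) * ‖E k‖ ≤ C := by
  have h1 := tendsto_mul_rpow_sub_max hr hu a.re b.re
  have h2 := tendsto_mul_rpow_sub_max hr hv b.re a.re
  rw [max_comm] at h2
  have h3 := (h1.add h2).add (he (-max a.re b.re))
  obtain ⟨C, hC⟩ := exists_gt (max 0 ((if b.re ≤ a.re then 1 else 0) * ‖U‖ +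
    (if a.re ≤ b.re then 1 else 0) * ‖V‖ + 0))
  refine ⟨C, (le_max_left _ _).trans_lt hC, ?_⟩
  filter_upwards [h3.eventually_le_const ((le_max_right _ _).trans_lt hC), hE,
    hr.eventually_gt_atTop 0] with k k1 k2 k3
  exact (norm_two_terms_bounds hζ k3 _ k2).1.trans k1

/-- The reverse triangle inequality makes the phases irrelevant. If the real parts differ, one term
survives alone; if they agree, the limiting lower bound is `| ‖U‖ - ‖V‖ |`. -/
theorem exists_rpow_max_le_norm (hζ : ‖ζ‖ = 1) (hr : Tendsto r atTop atTop)
    (hE : ∀ᶠ k in atTop, E k = (r k : ℂ) ^ a * u k + (r k : ℂ) ^ b * (ζ ^ n k)⁻¹ * v k + e k)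
    (hu : Tendsto u atTop (𝓝 U)) (hv : Tendsto v atTop (𝓝 V))
    (he : ∀ p : ℝ, Tendsto (fun k => r k ^ p * ‖e k‖) atTop (𝓝 0)) (hU : U ≠ 0) (hV : V ≠ 0)
    (hne : a.re ≠ b.re ∨ ‖U‖ ≠ ‖V‖) :
    ∃ c > 0, ∀ᶠ k in atTop, c ≤ r k ^ (-max a.re b.re) * ‖E k‖ := by
  have h1 := tendsto_mul_rpow_sub_max hr hu a.re b.re
  have h2 := tendsto_mul_rpow_sub_max hr hv b.re a.re
  rw [max_comm] at h2
  have h3 := (h1.sub h2).abs.sub (he (-max a.re b.re))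
  have hpos : 0 < |(if b.re ≤ a.re then 1 else 0) * ‖U‖ -
      (if a.re ≤ b.re then 1 else 0) * ‖V‖| - 0 := by
    rw [sub_zero, abs_pos, sub_ne_zero]
    rcases lt_trichotomy a.re b.re with h | h | h
    · simpa [h.le, not_le.mpr h] using (norm_ne_zero_iff.mpr hV).symm
    · simpa [h] using hne.resolve_left (not_not.mpr h)
    · simpa [h.le, not_le.mpr h] using hU
  refine ⟨_, half_pos hpos, ?_⟩
  filter_upwards [h3.eventually_const_le (half_lt_self hpos), hE,
    hr.eventually_gt_atTop 0] with k k1 k2 k3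
  exact k1.trans (norm_two_terms_bounds hζ k3 _ k2).2

end size

/-- Complex powers of the radius vary slowly, so between consecutive indices only `ζ ^ (-k)` turns
the relative phase. -/
theorem tendsto_scaleRadius_ratio_cpow {lam : ℝ} (hlam : 0 < lam) (s : ℂ) :
    Tendsto (fun k : ℕ => (scaleRadius lam (k + 1) : ℂ) ^ s / (scaleRadius lam k : ℂ) ^ s) atTop
      (𝓝 1) := by
  have h1 : Tendsto (fun k : ℕ => 1 + 1 / (k : ℝ)) atTop (𝓝 1) := by
    simpa using (tendsto_one_div_atTop_nhds_zero_nat (𝕜 := ℝ)).const_add 1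
  have h2 : Tendsto (fun k : ℕ => Complex.exp (((1 / lam * Real.log (1 + 1 / (k : ℝ)) : ℝ) : ℂ) * s))
      atTop (𝓝 1) := by
    have := (Complex.continuous_exp.tendsto _).comp (((Complex.continuous_ofReal.tendsto _).comp
      ((h1.log one_ne_zero).const_mul (1 / lam))).mul_const s)
    simpa [Function.comp_def] using this
  refine h2.congr' ?_
  filter_upwards [eventually_gt_atTop 0] with k hk
  have hk' : (0 : ℝ) < k := by exact_mod_cast hk
  have hr := scaleRadius_pos hlam hk
  have hr1 : 0 < scaleRadius lam (k + 1) := scaleRadius_pos hlam (Nat.succ_pos k)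
  have e0 : ∀ m : ℕ, 0 < m → Real.log (scaleRadius lam m) =
      1 / lam * (Real.log m - Real.log lam) := by
    intro m hm
    have hm' : (0 : ℝ) < m := by exact_mod_cast hm
    rw [scaleRadius, Real.log_rpow (by positivity), Real.log_div hm'.ne' hlam.ne']
  rw [Complex.cpow_def_of_ne_zero (by exact_mod_cast hr1.ne'),
    Complex.cpow_def_of_ne_zero (by exact_mod_cast hr.ne'), ← Complex.exp_sub, ← sub_mul,
    ← Complex.ofReal_log hr.le, ← Complex.ofReal_log hr1.le, ← Complex.ofReal_sub,
    e0 k hk, e0 (k + 1) (Nat.succ_pos k)]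
  congr 4
  rw [show (1 : ℝ) + 1 / k = ((k + 1 : ℕ) : ℝ) / k by push_cast; field_simp,
    Real.log_div (by positivity) hk'.ne']
  ring

/-- Along the full sequence of indices the two terms cannot cancel at all large indices. -/
theorem exists_frequently_rpow_max_le_norm {lam : ℝ} (hlam : 0 < lam) {a b ζ U V : ℂ}
    {E u v e : ℕ → ℂ} (hζ : ‖ζ‖ = 1) (hζ1 : ζ ≠ 1)
    (hE : ∀ᶠ k in atTop, E k = (scaleRadius lam k : ℂ) ^ a * u k +
      (scaleRadius lam k : ℂ) ^ b * (ζ ^ k)⁻¹ * v k + e k)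
    (hu : Tendsto u atTop (𝓝 U)) (hv : Tendsto v atTop (𝓝 V))
    (he : ∀ p : ℝ, Tendsto (fun k => scaleRadius lam k ^ p * ‖e k‖) atTop (𝓝 0)) (hU : U ≠ 0)
    (hV : V ≠ 0) :
    ∃ c > 0, ∃ᶠ k in atTop, c ≤ scaleRadius lam k ^ (-max a.re b.re) * ‖E k‖ := by
  have hr := tendsto_scaleRadius hlam
  by_cases hab : a.re = b.re
  swap
  · obtain ⟨c, hc, h⟩ := exists_rpow_max_le_norm (n := id) hζ hr hE hu hv he hU hV (Or.inl hab)
    exact ⟨c, hc, h.frequently⟩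
  by_contra! hcon
  have hζ0 : ζ ≠ 0 := by
    rintro rfl
    simp at hζ
  rw [hab, max_self] at hcon
  have hpos : ∀ᶠ k in atTop, 0 < scaleRadius lam k := hr.eventually_gt_atTop 0
  have hE0 : Tendsto (fun k => scaleRadius lam k ^ (-b.re) * ‖E k‖) atTop (𝓝 0) := by
    rw [Metric.tendsto_nhds]
    intro ε hε
    filter_upwards [hcon ε hε, hpos] with k hk hk0
    rw [Real.dist_eq, sub_zero, abs_of_nonneg (by positivity)]
    exact hk
  -- The relative phase of the two terms; it is unimodular because `Re a = Re b`.
  set x : ℕ → ℂ := fun k => (scaleRadius lam k : ℂ) ^ (b - a) * (ζ ^ k)⁻¹ with hx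
  have hxnorm : ∀ᶠ k in atTop, ‖x k‖ = 1 := by
    filter_upwards [hpos] with k hk
    rw [hx, norm_mul, Complex.norm_cpow_eq_rpow_re_of_pos hk, norm_inv, norm_pow, hζ,
      Complex.sub_re, hab]
    simp
  have hzero : Tendsto (fun k => u k + x k * v k) atTop (𝓝 0) := by
    have hsum := hE0.add (he (-b.re))
    rw [add_zero] at hsum
    refine squeeze_zero_norm' ?_ hsum
    filter_upwards [hE, hpos] with k hk hk0
    have hC : (scaleRadius lam k : ℂ) ≠ 0 := by exact_mod_cast hk0.ne'
    have hCa : (scaleRadius lam k : ℂ) ^ a ≠ 0 := by simp [Complex.cpow_eq_zero_iff, hC]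
    have e1 : u k + x k * v k = (scaleRadius lam k : ℂ) ^ (-a) * (E k - e k) := by
      rw [hk, hx, Complex.cpow_neg]
      simp only
      rw [Complex.cpow_sub _ _ hC]
      field_simp
      ring
    rw [e1, norm_mul, Complex.norm_cpow_eq_rpow_re_of_pos hk0, Complex.neg_re, hab, ← mul_add]
    gcongr
    exact norm_sub_le _ _
  -- Total cancellation would make `x k` converge to `-U/V ≠ 0`, hence its consecutive ratios to
  -- `1`; but those ratios tend to `ζ⁻¹`.
  have hxlim : Tendsto x atTop (𝓝 ((0 - U) / V)) := by
    refine ((hzero.sub hu).div hv hV).congr' ?_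
    filter_upwards [hv.eventually_ne hV] with k hk
    simp only [Pi.div_apply]
    field_simp
    ring
  have hX : (0 - U) / V ≠ 0 := by simp [hU, hV]
  have hratio : Tendsto (fun k => x (k + 1) / x k) atTop (𝓝 1) := by
    have := (hxlim.comp (tendsto_add_atTop_nat 1)).div hxlim hX
    rwa [div_self hX] at this
  have hratio2 : Tendsto (fun k => x (k + 1) / x k) atTop (𝓝 (1 * ζ⁻¹)) := by
    refine ((tendsto_scaleRadius_ratio_cpow hlam (b - a)).mul_const ζ⁻¹).congr fun k => ?_
    simp only [hx]
    rw [pow_succ]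
    field_simp
  have := tendsto_nhds_unique hratio hratio2
  rw [one_mul, eq_comm, inv_eq_one] at this
  exact hζ1 this

/-! ### From a logarithmic estimate to the rate; nonvanishing of `A`. -/

/-- With `L = log M = O(log x / x)`, the error `M - 1 - L` is `O(L²)`, hence `O(1/x)`. The side is
the sign of `L`, decided by `κ log x` once it exceeds `C` in absolute value. -/
theorem rate_of_log_rate {x M : ℕ → ℝ} {κ C : ℝ} (hx : Tendsto x atTop atTop)
    (hM : ∀ᶠ k in atTop, 0 < M k)
    (h : ∀ᶠ k in atTop, |x k * Real.log (M k) - κ * Real.log (x k)| ≤ C) :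
    ((fun k => M k - (1 + κ * (Real.log (x k) / x k))) =O[atTop] fun k => (x k)⁻¹) ∧
    (0 < κ → ∀ᶠ k in atTop, 1 < M k) ∧ (κ < 0 → ∀ᶠ k in atTop, M k < 1) := by
  have hlog : Tendsto (fun k => Real.log (x k)) atTop atTop := Real.tendsto_log_atTop.comp hx
  refine ⟨?_, fun hκ => ?_, fun hκ => ?_⟩
  · have hsq : Tendsto (fun k => (|κ| * Real.log (x k) + C) ^ 2 / x k) atTop (𝓝 0) := by
      have h0 : ∀ m : ℕ, Tendsto (fun k => Real.log (x k) ^ m / x k) atTop (𝓝 0) := by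
        intro m
        have := (Real.tendsto_pow_log_div_mul_add_atTop 1 0 m one_ne_zero).comp hx
        simpa [Function.comp_def] using this
      have := (((h0 2).const_mul (|κ| ^ 2)).add ((h0 1).const_mul (2 * |κ| * C))).add
        ((h0 0).const_mul (C ^ 2))
      simp only [mul_zero, add_zero] at this
      refine this.congr fun k => ?_
      ring
    have hlin : Tendsto (fun k => (|κ| * Real.log (x k) + C) / x k) atTop (𝓝 0) := by
      have h0 : ∀ m : ℕ, Tendsto (fun k => Real.log (x k) ^ m / x k) atTop (𝓝 0) := by
        intro m
        have := (Real.tendsto_pow_log_div_mul_add_atTop 1 0 m one_ne_zero).comp hx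
        simpa [Function.comp_def] using this
      have := ((h0 1).const_mul |κ|).add ((h0 0).const_mul C)
      simp only [mul_zero, add_zero] at this
      refine this.congr fun k => ?_
      ring
    refine IsBigO.of_bound (C + 1) ?_
    filter_upwards [h, hM, hx.eventually_gt_atTop 0, hlog.eventually_ge_atTop 0,
      hsq.eventually_le_const one_pos, hlin.eventually_le_const one_pos] with k k1 k2 k3 k4 k5 k6
    set L := Real.log (M k) with hL
    have hxL : |x k * L| ≤ |κ| * Real.log (x k) + C := by
      have := abs_add_le (x k * L - κ * Real.log (x k)) (κ * Real.log (x k))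
      rw [sub_add_cancel, abs_mul κ, abs_of_nonneg k4] at this
      linarith
    have hLb : |L| ≤ (|κ| * Real.log (x k) + C) / x k := by
      rw [le_div_iff₀ k3]
      rwa [abs_mul, abs_of_pos k3, mul_comm] at hxL
    have hexp := Real.abs_exp_sub_one_sub_id_le (hLb.trans k6)
    rw [hL, Real.exp_log k2, ← hL] at hexp
    have hL2 : L ^ 2 ≤ (x k)⁻¹ := by
      rw [← sq_abs]
      calc |L| ^ 2 ≤ ((|κ| * Real.log (x k) + C) / x k) ^ 2 := by gcongr
        _ = (|κ| * Real.log (x k) + C) ^ 2 / x k * (x k)⁻¹ := by field_simp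
        _ ≤ 1 * (x k)⁻¹ := by gcongr
        _ = _ := one_mul _
    have hmain : |L - κ * (Real.log (x k) / x k)| ≤ C * (x k)⁻¹ := by
      have : L - κ * (Real.log (x k) / x k) =
          (x k * L - κ * Real.log (x k)) * (x k)⁻¹ := by field_simp
      rw [this, abs_mul, abs_of_pos (inv_pos.mpr k3)]
      gcongr
    rw [Real.norm_eq_abs, Real.norm_of_nonneg (inv_pos.mpr k3).le]
    calc |M k - (1 + κ * (Real.log (x k) / x k))|
        = |(M k - 1 - L) + (L - κ * (Real.log (x k) / x k))| := by ring_nf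
      _ ≤ |M k - 1 - L| + |L - κ * (Real.log (x k) / x k)| := abs_add_le _ _
      _ ≤ (x k)⁻¹ + C * (x k)⁻¹ := add_le_add (hexp.trans hL2) hmain
      _ = _ := by ring
  · filter_upwards [h, hM, hx.eventually_gt_atTop 0,
      (hlog.const_mul_atTop hκ).eventually_gt_atTop C] with k k1 k2 k3 k4
    have := (abs_le.mp k1).1
    exact (Real.log_pos_iff k2.le).mp (pos_of_mul_pos_right (by linarith) k3.le)
  · filter_upwards [h, hM, hx.eventually_gt_atTop 0,
      (hlog.const_mul_atTop (neg_pos.mpr hκ)).eventually_gt_atTop C] with k k1 k2 k3 k4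
    have := (abs_le.mp k1).2
    refine (Real.log_neg_iff k2).mp ?_
    by_contra! h0
    have := mul_nonneg k3.le h0
    linarith

/-- Equivalence to the zero function means eventual equality, so `A = 0` would make `f` vanish on an
open piece of the second sector. Then `f = 0` by the identity theorem, against the growth in the
first sector. -/
theorem HasTwoDirections.amplitude_ne_zero {f : ℂ → ℂ} {a b A ζ : ℂ} {lam μ θ : ℝ}
    (H : HasTwoDirections f a b A ζ lam μ θ) (hf : Differentiable ℂ f) (hζ : ζ ≠ 0) (hθ : 0 < θ) :
    A ≠ 0 := by
  rintro rfl
  have h1 : f =ᶠ[Bornology.cobounded ℂ ⊓ 𝓟 (closedSector ζ θ)] 0 := by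
    have := H.second
    simp only [zero_mul] at this
    exact isEquivalent_zero_iff_eventually_zero.mp this
  have h2 : ∃ R : ℝ, ∀ z : ℂ, R ≤ ‖z‖ → z ∈ closedSector ζ θ → f z = 0 := by
    have h1' : ∀ᶠ z in Bornology.cobounded ℂ ⊓ 𝓟 (closedSector ζ θ), f z = 0 := h1
    rw [eventually_inf_principal, ← comap_norm_atTop, eventually_comap] at h1'
    obtain ⟨R, hR⟩ := eventually_atTop.mp h1'
    exact ⟨R, fun z hz hs => hR _ hz z rfl hs⟩
  obtain ⟨R, hR⟩ := h2
  set p : ℂ := ((|R| + 1) / ‖ζ‖ : ℝ) * ζ with hp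
  have hζn : 0 < ‖ζ‖ := norm_pos_iff.mpr hζ
  have hc : (0 : ℝ) < (|R| + 1) / ‖ζ‖ := by positivity
  have hpn : ‖p‖ = |R| + 1 := by
    rw [hp, norm_mul, Complex.norm_real, Real.norm_of_nonneg hc.le]
    field_simp
  have hpd : p / ζ = ((|R| + 1) / ‖ζ‖ : ℝ) := by rw [hp, mul_div_cancel_right₀ _ hζ]
  have harg : ContinuousAt (fun z : ℂ => |Complex.arg (z / ζ)|) p := by
    have : ContinuousAt Complex.arg (p / ζ) := by
      rw [hpd]
      exact Complex.continuousAt_arg (Complex.ofReal_mem_slitPlane.mpr hc)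
    exact (this.comp (f := fun z : ℂ => z / ζ) (by fun_prop)).abs
  have hp0 : |Complex.arg (p / ζ)| < θ := by
    rw [hpd, Complex.arg_ofReal_of_nonneg hc.le, abs_zero]
    exact hθ
  have hev : f =ᶠ[𝓝 p] 0 := by
    filter_upwards [harg.eventually_lt_const hp0, continuous_norm.continuousAt.eventually_const_lt
      (show R < ‖p‖ by rw [hpn]; linarith [le_abs_self R])] with z hz1 hz2
    exact hR z hz2.le hz1.le
  have hfz : f = 0 := AnalyticOnNhd.eq_of_eventuallyEq (𝕜 := ℂ)
    (fun z _ => hf.analyticAt z) (fun z _ => analyticAt_const) hev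
  have h3 := H.tendsto_first
  simp only [hfz, Pi.zero_apply, zero_div] at h3
  have hne : (Bornology.cobounded ℂ ⊓ 𝓟 (closedSector 1 θ)).NeBot := by
    have : Tendsto (fun x : ℝ => (x : ℂ)) atTop
        (Bornology.cobounded ℂ ⊓ 𝓟 (closedSector 1 θ)) := by
      refine tendsto_inf.mpr ⟨?_, tendsto_principal.mpr ?_⟩
      · rw [← tendsto_norm_atTop_iff_cobounded]
        simpa using tendsto_abs_atTop_atTop
      · filter_upwards [eventually_ge_atTop 0] with x hx
        change |Complex.arg _| ≤ θ
        rw [div_one, Complex.arg_ofReal_of_nonneg hx, abs_zero]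
        exact hθ.le
    exact this.neBot
  exact zero_ne_one (tendsto_nhds_unique tendsto_const_nhds h3)

/-! ### Locating the limit point by comparing the two sizes. -/

section Location

variable {lam θ s σ : ℝ} {n : ℕ → ℕ} {z : ℕ → ℂ} {z₀ : ℂ} {h c N : ℕ → ℝ} {c₀ : ℝ}

/-- If the limit exceeded `1`, the power of the modulus would decay exponentially, against a lower
bound by a power of `n`. The other branch is zero, so a bound at infinitely many indices is enough.
-/
theorem modulus_le_one (hlam : 0 < lam) (hn : Tendsto n atTop atTop)
    (hz : Tendsto z atTop (𝓝 z₀)) (hslit : z₀ ∈ Complex.slitPlane) (hc : Tendsto c atTop (𝓝 c₀))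
    (hc₀ : 0 < c₀)
    (hN : ∀ᶠ k in atTop, N k =
      if ‖z k‖ < Real.exp (h k) then
        c k * √(n k) * scaleRadius lam (n k) ^ s * szegoModulus lam (z k) ^ (-(n k / lam : ℝ))
      else 0)
    (hlow : ∃ m > 0, ∃ᶠ k in atTop, m ≤ scaleRadius lam (n k) ^ (-σ) * N k) :
    szegoModulus lam z₀ ≤ 1 := by
  by_contra! hM
  obtain ⟨m, hm, hfreq⟩ := hlow
  obtain ⟨q, hq1, hq2⟩ := exists_between hM
  have hMt : Tendsto (fun k => szegoModulus lam (z k)) atTop (𝓝 (szegoModulus lam z₀)) :=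
    (continuousAt_szegoModulus lam hslit).tendsto.comp hz
  have hlim := (tendsto_rpow_mul_rpow_mul_exp hlam (s - σ) (1 / 2) (ε := Real.log q / lam)
    (div_pos (Real.log_pos hq1) hlam) hn).const_mul (2 * c₀)
  rw [mul_zero] at hlim
  refine hfreq ?_
  filter_upwards [hN, hMt.eventually_const_le hq2, hlim.eventually_lt_const hm,
    hn.eventually_gt_atTop 0, hc.eventually_le_const (show c₀ < 2 * c₀ by linarith)]
    with k k1 k2 k3 k4 k5
  have hr := scaleRadius_pos hlam k4
  rw [not_le, k1]
  split_ifs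
  · refine lt_of_le_of_lt ?_ k3
    have hMq : szegoModulus lam (z k) ^ (-(n k / lam : ℝ)) ≤
        Real.exp (-(Real.log q / lam * n k)) := by
      have hq0 : 0 < q := by linarith
      calc _ ≤ q ^ (-(n k / lam : ℝ)) :=
            Real.rpow_le_rpow_of_nonpos hq0 k2 (neg_nonpos.mpr (by positivity))
        _ = _ := by
          rw [Real.rpow_def_of_pos hq0]
          congr 1
          ring
    have e1 : scaleRadius lam (n k) ^ (s - σ) =
        scaleRadius lam (n k) ^ (-σ) * scaleRadius lam (n k) ^ s := by
      rw [sub_eq_neg_add, Real.rpow_add hr]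
    rw [e1, ← Real.sqrt_eq_rpow]
    calc _ ≤ scaleRadius lam (n k) ^ (-σ) * (2 * c₀ * √(n k) * scaleRadius lam (n k) ^ s *
          Real.exp (-(Real.log q / lam * n k))) := by
          gcongr
          exact Real.rpow_nonneg (norm_nonneg _) _
      _ = _ := by ring
  · simpa using hm

/-- If the limit were below `1`, the power of the modulus would grow exponentially, against the
upper bound; `‖z₀‖ < 1` puts the zeros inside the contour, in the nonzero branch. -/
theorem one_le_modulus (hlam : 0 < lam) (hn : Tendsto n atTop atTop)
    (hz : Tendsto z atTop (𝓝 z₀)) (hslit : z₀ ∈ Complex.slitPlane) (hz₀ : ‖z₀‖ < 1)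
    (hh : ∀ k, 0 ≤ h k) (hc : Tendsto c atTop (𝓝 c₀)) (hc₀ : 0 < c₀)
    (hN : ∀ᶠ k in atTop, N k =
      if ‖z k‖ < Real.exp (h k) then
        c k * √(n k) * scaleRadius lam (n k) ^ s * szegoModulus lam (z k) ^ (-(n k / lam : ℝ))
      else 0)
    (hup : ∃ C > 0, ∀ᶠ k in atTop, scaleRadius lam (n k) ^ (-σ) * N k ≤ C) :
    1 ≤ szegoModulus lam z₀ := by
  by_contra! hM
  obtain ⟨C, hC, hev⟩ := hup
  obtain ⟨q, hq1, hq2⟩ := exists_between hM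
  have hq0 : 0 < q := (szegoModulus_pos lam (Complex.slitPlane_ne_zero hslit)).trans hq1
  have hMt : Tendsto (fun k => szegoModulus lam (z k)) atTop (𝓝 (szegoModulus lam z₀)) :=
    (continuousAt_szegoModulus lam hslit).tendsto.comp hz
  have hlim := (tendsto_rpow_mul_rpow_mul_exp hlam (σ - s) (-(1 / 2)) (ε := -Real.log q / lam)
    (div_pos (neg_pos.mpr (Real.log_neg hq0 hq2)) hlam) hn).const_mul (2 * C / c₀)
  rw [mul_zero] at hlim
  obtain ⟨k, k1, k2, k3, k4, k5, k6, k7, k8⟩ := (hN.and ((hMt.eventually_le_const hq1).and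
    ((hlim.eventually_lt_const one_pos).and ((hn.eventually_gt_atTop 0).and
    ((hc.eventually_const_le (half_lt_self hc₀)).and ((hz.norm.eventually_lt_const hz₀).and
    (hev.and (hz.eventually_ne (Complex.slitPlane_ne_zero hslit))))))))).exists
  have hr := scaleRadius_pos hlam k4
  have hn' : (0 : ℝ) < n k := by exact_mod_cast k4
  rw [k1, if_pos (k6.trans_le (Real.one_le_exp (hh k)))] at k7
  have hMq : Real.exp (-Real.log q / lam * n k) ≤ szegoModulus lam (z k) ^ (-(n k / lam : ℝ)) := by
    calc _ = q ^ (-(n k / lam : ℝ)) := by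
          rw [Real.rpow_def_of_pos hq0]
          congr 1
          ring
      _ ≤ _ := Real.rpow_le_rpow_of_nonpos (szegoModulus_pos lam k8) k2
          (neg_nonpos.mpr (by positivity))
  have k9 : scaleRadius lam (n k) ^ (-σ) * (c₀ / 2 * √(n k) * scaleRadius lam (n k) ^ s *
      Real.exp (-Real.log q / lam * n k)) ≤ C := by
    have : 0 ≤ c k := (half_pos hc₀).le.trans k5
    exact le_trans (by gcongr) k7
  refine absurd k3 (not_lt.mpr ?_)
  have e1 : scaleRadius lam (n k) ^ (σ - s) =
      (scaleRadius lam (n k) ^ (-σ) * scaleRadius lam (n k) ^ s)⁻¹ := by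
    rw [← Real.rpow_add hr, ← Real.rpow_neg hr.le]
    congr 1
    ring
  rw [e1, Real.rpow_neg hn'.le, ← Real.sqrt_eq_rpow, Real.exp_neg]
  have hsq : 0 < √(n k : ℝ) := Real.sqrt_pos.mpr hn'
  have hp : 0 < scaleRadius lam (n k) ^ (-σ) := by positivity
  have hp' : 0 < scaleRadius lam (n k) ^ s := by positivity
  have he := Real.exp_pos (-Real.log q / lam * n k)
  rw [← mul_inv, ← mul_inv, ← div_eq_mul_inv, le_div_iff₀ (by positivity), one_mul,
    le_div_iff₀ hc₀]
  linarith

/-- The normalized size lies between two positive constants, so its logarithm is bounded. The factor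
`√n` yields `λ/2`, and the powers of the radius yield `s - σ`, because `log r_n` is `log n / λ` up
to a constant. -/
theorem log_modulus_rate (hlam : 0 < lam) (hn : Tendsto n atTop atTop)
    (hz : Tendsto z atTop (𝓝 z₀)) (hz0 : z₀ ≠ 0) (hz₀ : ‖z₀‖ < 1)
    (hh : ∀ k, 0 ≤ h k) (hc : Tendsto c atTop (𝓝 c₀)) (hc₀ : 0 < c₀)
    (hN : ∀ᶠ k in atTop, N k =
      if ‖z k‖ < Real.exp (h k) then
        c k * √(n k) * scaleRadius lam (n k) ^ s * szegoModulus lam (z k) ^ (-(n k / lam : ℝ))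
      else 0)
    (hup : ∃ C > 0, ∀ᶠ k in atTop, scaleRadius lam (n k) ^ (-σ) * N k ≤ C)
    (hlow : ∃ m > 0, ∀ᶠ k in atTop, m ≤ scaleRadius lam (n k) ^ (-σ) * N k) :
    ∃ C, ∀ᶠ k in atTop, |(n k : ℝ) * Real.log (szegoModulus lam (z k)) -
      (s - σ + lam / 2) * Real.log (n k)| ≤ C := by
  obtain ⟨C, hC, hC'⟩ := hup
  obtain ⟨m, hm, hm'⟩ := hlow
  have hlc := (hc.log hc₀.ne').norm.eventually_le_const (lt_add_one _)
  refine ⟨lam * (‖Real.log c₀‖ + 1 + (|Real.log C| + |Real.log m|)) +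
    |(s - σ) * Real.log lam|, ?_⟩
  filter_upwards [hN, hC', hm', hlc, hn.eventually_gt_atTop 0, hz.eventually_ne hz0,
    hz.norm.eventually_lt_const hz₀, hc.eventually_const_lt hc₀] with k k1 k2 k3 k4 k5 k6 k7 k8
  have hr := scaleRadius_pos hlam k5
  have hn' : (0 : ℝ) < n k := by exact_mod_cast k5
  have hM := szegoModulus_pos lam k6
  rw [k1, if_pos (k7.trans_le (Real.one_le_exp (hh k)))] at k2 k3
  set T := scaleRadius lam (n k) ^ (-σ) * (c k * √(n k) * scaleRadius lam (n k) ^ s *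
    szegoModulus lam (z k) ^ (-(n k / lam : ℝ))) with hT
  have hTpos : 0 < T := hm.trans_le k3
  have hsq : 0 < √(n k : ℝ) := Real.sqrt_pos.mpr hn'
  have hlr : Real.log (scaleRadius lam (n k)) = 1 / lam * (Real.log (n k) - Real.log lam) := by
    rw [scaleRadius, Real.log_rpow (by positivity), Real.log_div hn'.ne' hlam.ne']
  have hlogT : Real.log T = -σ * (1 / lam * (Real.log (n k) - Real.log lam)) +
      (Real.log (c k) + Real.log (n k) / 2 + s * (1 / lam * (Real.log (n k) - Real.log lam)) +
        -(n k / lam) * Real.log (szegoModulus lam (z k))) := by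
    rw [hT, Real.log_mul (by positivity) (by positivity),
      Real.log_mul (by positivity) (by positivity), Real.log_mul (by positivity) (by positivity),
      Real.log_mul (by positivity) (by positivity), Real.log_rpow hr, Real.log_rpow hr,
      Real.log_rpow hM, Real.log_sqrt hn'.le, hlr]
  have hTb : |Real.log T| ≤ |Real.log C| + |Real.log m| := by
    have t1 := Real.log_le_log hTpos k2
    have t2 := Real.log_le_log hm k3
    rw [abs_le]
    constructor
    · linarith [neg_abs_le (Real.log m), abs_nonneg (Real.log C)]
    · linarith [le_abs_self (Real.log C), abs_nonneg (Real.log m)]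
  have hkey : (n k : ℝ) * Real.log (szegoModulus lam (z k)) -
      (s - σ + lam / 2) * Real.log (n k) =
      lam * (Real.log (c k) - Real.log T) - (s - σ) * Real.log lam := by
    rw [hlogT]
    field_simp
    ring
  rw [hkey]
  refine (abs_sub _ _).trans ?_
  gcongr
  rw [abs_mul, abs_of_pos hlam]
  gcongr
  refine (abs_sub _ _).trans ?_
  gcongr
  exact k4

end Location

/-- The data extracted from a sequence of zeros tending to a point other than the corner: a
sequence `E` controlled both by the saddle points and by the size of `f` at the zeros. -/
theorem HasTwoDirections.exists_contour_data {f : ℂ → ℂ} {a b A ζ : ℂ} {lam μ θ : ℝ}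
    (H : HasTwoDirections f a b A ζ lam μ θ) (hf : Differentiable ℂ f) (hlam : 0 < lam)
    (hμ : μ < 1) (hζ : ‖ζ‖ = 1) (hζ1 : ζ ≠ 1) (hθ : 0 < θ) (hθπ : θ < Real.pi)
    (hone : lam * θ < 2 * Real.pi) {n : ℕ → ℕ} {z : ℕ → ℂ} {z₀ : ℂ} (hz₀ : z₀ ≠ 0)
    (harg : |Complex.arg z₀| < θ) (Z : ZerosTendTo f lam n z z₀) (hz1 : z₀ ≠ 1) (hzζ : z₀ ≠ ζ) :
    ∃ (h c : ℕ → ℝ) (c₀ : ℝ) (E u v e : ℕ → ℂ),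
      (∀ k, 0 ≤ h k) ∧ Tendsto h atTop (𝓝 0) ∧ 0 < c₀ ∧ Tendsto c atTop (𝓝 c₀) ∧
      (∀ᶠ k in atTop, ‖E k‖ =
        if ‖z k‖ < Real.exp (h k) then
          c k * √(n k) * scaleRadius lam (n k) ^ a.re * szegoModulus lam (z k) ^ (-(n k / lam : ℝ))
        else 0) ∧
      (∀ᶠ k in atTop, E k = (scaleRadius lam (n k) : ℂ) ^ a * u k +
          (scaleRadius lam (n k) : ℂ) ^ b * (ζ ^ n k)⁻¹ * v k + e k) ∧
      Tendsto u atTop (𝓝 (√(2 * Real.pi / lam) * (1 / (1 - z₀)))) ∧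
      Tendsto v atTop (𝓝 (√(2 * Real.pi / lam) * (A / (1 - z₀ / ζ)))) ∧
      ∀ p : ℝ, Tendsto (fun k => scaleRadius lam (n k) ^ p * ‖e k‖) atTop (𝓝 0) := by
  have hn := Z.1
  have hex : ∀ k, ∃ h : ℝ, 0 ≤ h ∧ h * n k ≤ 1 ∧
      (0 < n k → 1 / (2 * n k : ℝ) ≤ |Real.exp h - ‖z k‖|) := by
    intro k
    rcases Nat.eq_zero_or_pos (n k) with h0 | h0
    · exact ⟨0, le_rfl, by simp, fun h => absurd h h0.not_gt⟩
    · obtain ⟨h, h1, h2, h3⟩ := exists_contour_height ‖z k‖ h0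
      exact ⟨h, h1, h2, fun _ => h3⟩
  choose h h0 h1 h2 using hex
  have hdist : ∀ᶠ k in atTop, 1 / (2 * n k : ℝ) ≤ |Real.exp (h k) - ‖z k‖| := by
    filter_upwards [hn.eventually_gt_atTop 0] with k hk using h2 k hk
  have hne : ∀ᶠ k in atTop, ‖z k‖ ≠ Real.exp (h k) := by
    filter_upwards [hdist, hn.eventually_gt_atTop 0] with k hk hnk e
    have hnk' : (0 : ℝ) < n k := by exact_mod_cast hnk
    rw [e, sub_self, abs_zero] at hk
    have : 0 < 1 / (2 * n k : ℝ) := by positivity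
    linarith
  obtain ⟨c, ⟨c₀, hc₀, hc⟩, hN⟩ :=
    H.norm_scaledRemainder_at_zeros hf hlam hθπ hz₀ harg Z hne
  obtain ⟨u, v, e, hE, hu, hv, he⟩ := H.scaledRemainder_asymptotics hf.continuous hlam hμ hζ hζ1
    hθ hone hn h0 h1 Z.2.2 hz1 hzζ hdist
  exact ⟨h, c, c₀, _, u, v, e, h0, tendsto_height (tendsto_natCast_atTop_atTop.comp hn) h0 h1,
    hc₀, hc, hN, hE, hu, hv, he⟩

/-- A limit outside the closed disc would make the remainder vanish for all large indices, and on
the unit circle a modulus at most `1` forces the corner `z₀ = 1`. Once inside, both bounds on the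
modulus apply. -/
theorem limit_location {lam θ s σ : ℝ} {n : ℕ → ℕ} {z : ℕ → ℂ} {z₀ : ℂ} {h c : ℕ → ℝ} {c₀ : ℝ}
    {E : ℕ → ℂ} (hlam : 0 < lam) (hθπ : θ < Real.pi) (hone : lam * θ < 2 * Real.pi)
    (hz₀ : z₀ ≠ 0) (harg : |Complex.arg z₀| < θ) (hz1 : z₀ ≠ 1) (hn : Tendsto n atTop atTop)
    (hz : Tendsto z atTop (𝓝 z₀)) (hh : ∀ k, 0 ≤ h k) (hh0 : Tendsto h atTop (𝓝 0))
    (hc₀ : 0 < c₀) (hc : Tendsto c atTop (𝓝 c₀))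
    (hN : ∀ᶠ k in atTop, ‖E k‖ =
      if ‖z k‖ < Real.exp (h k) then
        c k * √(n k) * scaleRadius lam (n k) ^ s * szegoModulus lam (z k) ^ (-(n k / lam : ℝ))
      else 0)
    (hup : ∃ C > 0, ∀ᶠ k in atTop, scaleRadius lam (n k) ^ (-σ) * ‖E k‖ ≤ C)
    (hlow : ∃ m > 0, ∃ᶠ k in atTop, m ≤ scaleRadius lam (n k) ^ (-σ) * ‖E k‖) :
    ‖z₀‖ < 1 ∧ szegoModulus lam z₀ = 1 := by
  have hslit := mem_slitPlane_of_abs_arg_lt hz₀ (harg.trans hθπ)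
  have hle := modulus_le_one hlam hn hz hslit hc hc₀ hN hlow
  have hlt : ‖z₀‖ < 1 := by
    refine lt_of_le_of_ne (le_of_not_gt fun hgt => ?_) fun heq =>
      hz1 (eq_one_of_norm_eq_one hlam hone harg heq hle)
    obtain ⟨m, hm, hfreq⟩ := hlow
    obtain ⟨q, hq1, hq2⟩ := exists_between hgt
    have hexp : Tendsto (fun k => Real.exp (h k)) atTop (𝓝 1) := by
      simpa [Function.comp_def] using (Real.continuous_exp.tendsto _).comp hh0
    refine hfreq ?_
    filter_upwards [hN, hexp.eventually_lt_const hq1, hz.norm.eventually_const_lt hq2]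
      with k k1 k2 k3
    rw [k1, if_neg (by linarith), mul_zero]
    exact not_le.mpr hm
  exact ⟨hlt, le_antisymm hle (one_le_modulus hlam hn hz hslit hlt hh hc hc₀ hN hup)⟩

/-! ### The theorem. -/

theorem one_mem_limitCurve (lam : ℝ) : (1 : ℂ) ∈ limitCurve lam := by
  constructor <;> simp [szegoModulus]

theorem mainTheorem6 (a b A ζ : ℂ) (lam μ θ : ℝ)
    (hlam : 0 < lam) (hμ : μ < 1) (hζ : ‖ζ‖ = 1) (hζ1 : ζ ≠ 1)
    (hθ : 0 < θ) (hθπ : θ < Real.pi)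
    -- the two sectors are disjoint (apart from the origin)
    (hdisj : ∀ z : ℂ, z ≠ 0 → ¬ (z ∈ closedSector 1 θ ∧ z ∈ closedSector ζ θ))
    -- each sector contains only one direction of maximal growth
    (hone : lam * θ < 2 * Real.pi)
    (f : ℂ → ℂ) (hf : Differentiable ℂ f)
    (hgrowth : HasTwoDirections f a b A ζ lam μ θ) :
    -- limits of sequences of zeros lie on the curve
    (∀ (z : ℕ → ℂ) (z₀ : ℂ), z₀ ≠ 0 → |Complex.arg z₀| < θ →
      ZerosTendTo f lam id z z₀ → z₀ ∈ limitCurve lam) ∧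
    (∀ (n : ℕ → ℕ) (z : ℕ → ℂ) (z₀ : ℂ), z₀ ≠ 0 → |Complex.arg z₀| < θ →
      (a.re ≠ b.re ∨ ‖ζ - z₀‖ ≠ ‖A * (1 - z₀)‖) →
      ZerosTendTo f lam n z z₀ →
      -- so do subsequential limits
      z₀ ∈ limitCurve lam ∧
      -- away from the corner, the rate and the side of approach
      (z₀ ≠ 1 →
        ((fun k => szegoModulus lam (z k) -
            (1 + (min a.re b.re - b.re + lam / 2) * (Real.log (n k) / (n k : ℝ))))
          =O[atTop] fun k => ((n k : ℝ))⁻¹) ∧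
        (0 < min a.re b.re - b.re + lam / 2 → ∀ᶠ k in atTop, 1 < szegoModulus lam (z k)) ∧
        (min a.re b.re - b.re + lam / 2 < 0 → ∀ᶠ k in atTop, szegoModulus lam (z k) < 1))) := by
  have hζ0 : ζ ≠ 0 := by
    rintro rfl
    simp at hζ
  have hA := hgrowth.amplitude_ne_zero hf hζ0 hθ
  have hs : 0 < √(2 * Real.pi / lam) := Real.sqrt_pos.mpr (by positivity)
  have hsC : ((√(2 * Real.pi / lam) : ℝ) : ℂ) ≠ 0 := by exact_mod_cast hs.ne'
  -- If `ζ` itself had argument below `θ`, it would lie in both sectors.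
  have hneζ : ∀ z₀ : ℂ, |Complex.arg z₀| < θ → z₀ ≠ ζ := by
    rintro z₀ harg rfl
    refine hdisj z₀ hζ0 ⟨?_, ?_⟩
    · change |Complex.arg (z₀ / 1)| ≤ θ
      rw [div_one]
      exact harg.le
    · change |Complex.arg (z₀ / z₀)| ≤ θ
      simp [hζ0, hθ.le]
  have hU : ∀ z₀ : ℂ, z₀ ≠ 1 → (√(2 * Real.pi / lam) : ℂ) * (1 / (1 - z₀)) ≠ 0 := fun z₀ hz =>
    mul_ne_zero hsC (one_div_ne_zero (sub_ne_zero.mpr hz.symm))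
  have hV : ∀ z₀ : ℂ, z₀ ≠ ζ → (√(2 * Real.pi / lam) : ℂ) * (A / (1 - z₀ / ζ)) ≠ 0 :=
    fun z₀ hz => mul_ne_zero hsC (div_ne_zero hA
      (sub_ne_zero.mpr (by rwa [ne_comm, Ne, div_eq_one_iff_eq hζ0])))
  constructor
  · intro z z₀ hz₀ harg Z
    -- At the corner the pole of the Cauchy factor meets the saddle and the asymptotics fail, but
    -- `1` lies on the curve anyway.
    rcases eq_or_ne z₀ 1 with rfl | hz1
    · exact one_mem_limitCurve lam
    obtain ⟨h, c, c₀, E, u, v, e, hh, hh0, hc₀, hc, hN, hE, hu, hv, he⟩ :=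
      hgrowth.exists_contour_data hf hlam hμ hζ hζ1 hθ hθπ hone hz₀ harg Z hz1 (hneζ z₀ harg)
    have hup := exists_norm_le_rpow_max hζ ((tendsto_scaleRadius hlam).comp Z.1) hE hu hv he
    have hlow := exists_frequently_rpow_max_le_norm hlam hζ hζ1 hE hu hv he (hU z₀ hz1)
      (hV z₀ (hneζ z₀ harg))
    obtain ⟨g1, g2⟩ := limit_location hlam hθπ hone hz₀ harg hz1 Z.1 Z.2.2 hh hh0 hc₀ hc hN hup hlow
    exact ⟨g2, g1.le⟩
  · intro n z z₀ hz₀ harg hcond Z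
    rcases eq_or_ne z₀ 1 with rfl | hz1
    · exact ⟨one_mem_limitCurve lam, fun h => absurd rfl h⟩
    obtain ⟨h, c, c₀, E, u, v, e, hh, hh0, hc₀, hc, hN, hE, hu, hv, he⟩ :=
      hgrowth.exists_contour_data hf hlam hμ hζ hζ1 hθ hθπ hone hz₀ harg Z hz1 (hneζ z₀ harg)
    -- Since `1 - z₀/ζ = (ζ - z₀)/ζ` and `|ζ| = 1`, the assumed inequality says exactly that the two
    -- limiting amplitudes have different moduli.
    have hcond' : a.re ≠ b.re ∨ ‖(√(2 * Real.pi / lam) : ℂ) * (1 / (1 - z₀))‖ ≠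
        ‖(√(2 * Real.pi / lam) : ℂ) * (A / (1 - z₀ / ζ))‖ := by
      refine hcond.imp_right fun hne heq => hne ?_
      have d1 : 0 < ‖1 - z₀‖ := norm_pos_iff.mpr (sub_ne_zero.mpr hz1.symm)
      have d2 : 0 < ‖ζ - z₀‖ := norm_pos_iff.mpr (sub_ne_zero.mpr (hneζ z₀ harg).symm)
      have e1 : 1 - z₀ / ζ = (ζ - z₀) / ζ := by field_simp
      rw [norm_mul, norm_mul, e1, norm_div, norm_div, norm_div, hζ, norm_one, div_one] at heq
      have h3 := mul_left_cancel₀ (norm_ne_zero_iff.mpr hsC) heq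
      rw [div_eq_div_iff d1.ne' d2.ne', one_mul] at h3
      rw [h3, norm_mul]
    have hr : Tendsto (fun k => scaleRadius lam (n k)) atTop atTop :=
      (tendsto_scaleRadius hlam).comp Z.1
    have hup := exists_norm_le_rpow_max hζ hr hE hu hv he
    have hlow := exists_rpow_max_le_norm hζ hr hE hu hv he (hU z₀ hz1) (hV z₀ (hneζ z₀ harg))
      hcond'
    obtain ⟨g1, g2⟩ := limit_location hlam hθπ hone hz₀ harg hz1 Z.1 Z.2.2 hh hh0 hc₀ hc hN hup
      (hlow.imp fun m hm => ⟨hm.1, hm.2.frequently⟩)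
    refine ⟨⟨g2, g1.le⟩, fun _ => ?_⟩
    obtain ⟨C, hC⟩ := log_modulus_rate hlam Z.1 Z.2.2 hz₀ g1 hh hc hc₀ hN hup hlow
    have hκ : a.re - max a.re b.re + lam / 2 = min a.re b.re - b.re + lam / 2 := by
      linarith [min_add_max a.re b.re]
    rw [hκ] at hC
    refine rate_of_log_rate (tendsto_natCast_atTop_atTop.comp Z.1) ?_ hC
    filter_upwards [Z.2.2.eventually_ne hz₀] with k hk using szegoModulus_pos lam hk
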